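/- A filtered space $X_*$ is a topological space $X$ with a sequence of subspaces $X_0\subseteq X_1\subseteq X_2\subseteq\cdots\subseteq X$; a filtered map $f:X_*\to Y_*$ is a continuous map $f:X\to Y$ with $f(X_k)\subseteq Y_k$ for all $k$. Let $I^n_*$ be the $n$-cube $I^n=[0,1]^n$ with its skeletal filtration ($I^n_k$ is the set of points with at most $k$ coordinates in the open interval $(0,1)$), let $R(X_*)_n$ be the set of filtered maps $I^n_*\to X_*$, and for $a,b\in R(X_*)_n$ write $a\equiv b$ if there is a homotopy from $a$ to $b$ through filtered maps that is constant on every vertex of $I^n$. Then $R(X_*)$ and $\varrho(X_*)=R(X_*)/\!\equiv$ are cubical sets with connections, with faces $\partial_i^\pm$, degeneracies $\varepsilon_i$ and connections $\Gamma_i^{\pm}$ induced by $$\partial_i^{-}a,\ \partial_i^+a:\ (t_1,\dots,t_{n-1})\mapsto a(t_1,\dots,t_{i-1},\eta,t_i,\dots,t_{n-1})\ \text{ with } \eta=0,\ 1\text{ respectively},$$ $$(\varepsilon_i a)(t_1,\dots,t_{n+1})=a(t_1,\dots,\widehat{t_i},\dots,t_{n+1}),\qquad (\Gamma_i^{\pm}a)(t_1,\dots,t_{n+1})=a(t_1,\dots,t_{i-1},m^{\pm}(t_i,t_{i+1}),t_{i+2},\dots,t_{n+1}),$$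 where $m^-=\max$, $m^+=\min$. For $a,b\in R(X_*)_n$ with $\partial_i^+a=\partial_i^-b$ ($1\le i\le n$) let $$(a\circ_i b)(t_1,\dots,t_n)=\begin{cases}a(\dots,2t_i,\dots)& t_i\le\frac12,\\ b(\dots,2t_i-1,\dots)& t_i\ge\frac12.\end{cases}$$ A cubical $\omega$-groupoid with connections is a cubical set with connections $K$ together with, for all $n\ge 1$ and $1\le i\le n$, a partial composition $\circ_i$ on $K_n$, where $a\circ_i b$ is defined exactly when $\partial_i^+a=\partial_i^-b$, which is a groupoid composition with source $\partial_i^-$, target $\partial_i^+$ and identities $\varepsilon_i x$ ($x\in K_{n-1}$), such that, whenever $a\circ_j b$ (and, in the interchange law, $a\circ_i b$, $c\circ_i d$, $a\circ_j c$, $b\circ_j d$) are defined, with $\alpha=\pm$: - $\partial_i^\alpha(a\circ_j b)$ equals $\partial_i^\alpha a\circ_{j-1}\partial_i^\alpha b$ if $i<j$, and $\partial_i^\alpha a\circ_{j}\partial_i^\alpha b$ if $i>j$; - $\varepsilon_i(a\circ_j b)$ equals $\varepsilon_i a\circ_{j+1}\varepsilon_i b$ if $i\le j$, and $\varepsilon_i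 a\circ_j\varepsilon_i b$ if $i>j$; - $(a\circ_i b)\circ_j(c\circ_i d)=(a\circ_j c)\circ_i(b\circ_j d)$ if $i\ne j$; - $\Gamma_i^\alpha(a\circ_j b)$ equals $\Gamma_i^\alpha a\circ_{j+1}\Gamma_i^\alpha b$ if $i<j$, and $\Gamma_i^\alpha a\circ_j\Gamma_i^\alpha b$ if $i>j$; - $\Gamma_j^-(a\circ_j b)=(\Gamma_j^-a\circ_{j+1}\varepsilon_j b)\circ_j(\varepsilon_{j+1}b\circ_{j+1}\Gamma_j^-b)$ and $\Gamma_j^+(a\circ_j b)=(\Gamma_j^+a\circ_{j+1}\varepsilon_{j+1} a)\circ_j(\varepsilon_{j}a\circ_{j+1}\Gamma_j^+b)$; - $\Gamma_i^+x\circ_i\Gamma_i^-x=\varepsilon_{i+1}x$ and $\Gamma_i^+x\circ_{i+1}\Gamma_i^-x=\varepsilon_i x$ for all $x\in K_n$, $1\le i\le n$. **Theorem.** Let $X_*$ be any filtered space, $n\ge1$ and $1\le i\le n$. 1. If $x,y\in\varrho(X_*)_n$ and $\partial_i^+x=\partial_i^-y$, then there are representatives $a$ of $x$ and $b$ of $y$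 with $\partial_i^+a=\partial_i^-b$. 2. If $a\equiv a'$ and $b\equiv b'$ in $R(X_*)_n$ with $\partial_i^+a=\partial_i^-b$ and $\partial_i^+a'=\partial_i^-b'$, then $a\circ_i b\equiv a'\circ_i b'$. 3. The cubical set with connections $\varrho(X_*)$ carries exactly one structure of cubical $\omega$-groupoid with connections such that $[a]\circ_i[b]=[a\circ_i b]$ for all $n\ge 1$, all $1\le i\le n$ and all $a,b\in R(X_*)_n$ with $\partial_i^+a=\partial_i^-b$ (the fundamental cubical $\omega$-groupoid of $X_*$). -/

import Mathlib

open scoped unitInterval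

universe u v w

/-! ### Filtered spaces and filtered maps -/

/-- A filtration `X₀ ⊆ X₁ ⊆ X₂ ⊆ ⋯ ⊆ X` of a topological space `X` by subspaces.  (As usual, the
union of the `Xₖ` need not be all of `X`.) -/
structure FilteredSpace (X : Type u) [TopologicalSpace X] where
  /-- the `k`-th subspace -/
  filt : ℕ → Set X
  mono : Monotone filt

/-- A continuous map is filtered if it maps the `k`-th subspace into the `k`-th subspace. -/
def IsFilteredMap {X : Type u} {Y : Type v} [TopologicalSpace X] [TopologicalSpace Y]
    (F : FilteredSpace X) (G : FilteredSpace Y) (f : C(X, Y)) : Prop :=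
  ∀ k, ∀ x ∈ F.filt k, f x ∈ G.filt k

/-- Morphisms in the category of filtered spaces. -/
def FilteredMap {X : Type u} {Y : Type v} [TopologicalSpace X] [TopologicalSpace Y]
    (F : FilteredSpace X) (G : FilteredSpace Y) : Type (max u v) :=
  {f : C(X, Y) // IsFilteredMap F G f}

namespace FilteredMap

variable {X : Type u} {Y : Type v} {Z : Type w}
  [TopologicalSpace X] [TopologicalSpace Y] [TopologicalSpace Z]
  {F : FilteredSpace X} {G : FilteredSpace Y} {H : FilteredSpace Z}

instance : CoeFun (FilteredMap F G) (fun _ => X → Y) := ⟨fun f => f.1⟩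

theorem ext {f g : FilteredMap F G} (h : ∀ x, f x = g x) : f = g :=
  Subtype.ext (ContinuousMap.ext h)

/-- Composition of filtered maps. -/
def comp (g : FilteredMap G H) (f : FilteredMap F G) : FilteredMap F H :=
  ⟨g.1.comp f.1, fun k x hx => g.2 k _ (f.2 k x hx)⟩

end FilteredMap

/-! ### The filtered cube and its standard structure maps -/

/-- The `n`-cube with its skeletal filtration: a point lies in the `k`-skeleton iff at most `k` of
its coordinates are different from `0` and `1`. -/
def cubeFilt (n : ℕ) : FilteredSpace (Fin n → I) where
  filt k := {t | {i | t i ≠ 0 ∧ t i ≠ 1}.ncard ≤ k}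
  mono _ _ hkl _ ht := le_trans ht hkl

theorem cubeFilt_of_injOn {m n : ℕ} {t : Fin m → I} {s : Fin n → I} (c : Fin n → Fin m)
    (hc : ∀ j, s j ≠ 0 ∧ s j ≠ 1 → t (c j) ≠ 0 ∧ t (c j) ≠ 1)
    (hinj : Set.InjOn c {j | s j ≠ 0 ∧ s j ≠ 1}) {k : ℕ} (ht : t ∈ (cubeFilt m).filt k) :
    s ∈ (cubeFilt n).filt k :=
  le_trans (Set.ncard_le_ncard_of_injOn c hc hinj (Set.toFinite _)) ht

/-- The two ends of the unit interval: `false` stands for the sign `-` and the end `0`, `true` for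
the sign `+` and the end `1`. -/
def endpoint : Bool → I
  | false => 0
  | true => 1

/-- `max` for the sign `-`, and `min` for the sign `+`. -/
def signMax : Bool → I → I → I
  | false => fun s t => max s t
  | true => fun s t => min s t

theorem continuous_signMax (α : Bool) : Continuous fun p : I × I => signMax α p.1 p.2 := by
  cases α
  · exact continuous_fst.max continuous_snd
  · exact continuous_fst.min continuous_snd

theorem signMax_mem (α : Bool) (s t : I) : signMax α s t = s ∨ signMax α s t = t := by
  cases α
  · exact max_choice s t
  · exact min_choice s t

/-- The inclusion of the face `tᵢ = 0` or `tᵢ = 1`. -/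
def coface {n : ℕ} (α : Bool) (i : Fin (n + 1)) : FilteredMap (cubeFilt n) (cubeFilt (n + 1)) :=
  ⟨⟨fun t => i.insertNth (endpoint α) t, by fun_prop⟩, by
    intro k t ht
    have key : {j | (i.insertNth (endpoint α) t : Fin (n + 1) → I) j ≠ 0 ∧
        (i.insertNth (endpoint α) t : Fin (n + 1) → I) j ≠ 1} ⊆
        i.succAbove '' {j | t j ≠ 0 ∧ t j ≠ 1} := by
      intro j hj
      rcases Fin.eq_self_or_eq_succAbove i j with rfl | ⟨l, rfl⟩
      · cases α <;> simp [endpoint] at hj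
      · exact ⟨l, by simpa using hj, rfl⟩
    exact le_trans (Set.ncard_le_ncard key (Set.toFinite _))
      (le_trans (Set.ncard_image_le (Set.toFinite _)) ht)⟩

/-- The projection omitting the coordinate `tᵢ`. -/
def codegen {n : ℕ} (i : Fin (n + 1)) : FilteredMap (cubeFilt (n + 1)) (cubeFilt n) :=
  ⟨⟨fun t j => t (i.succAbove j), by fun_prop⟩, fun _ _ ht =>
    cubeFilt_of_injOn i.succAbove (fun _ h => h) (Fin.succAbove_right_injective.injOn) ht⟩

/-- The map replacing the two coordinates `tᵢ, tᵢ₊₁` by the single coordinate `max tᵢ tᵢ₊₁`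
(sign `-`) or `min tᵢ tᵢ₊₁` (sign `+`). -/
def coconn {n : ℕ} (α : Bool) (i : Fin n) : FilteredMap (cubeFilt (n + 1)) (cubeFilt n) :=
  ⟨⟨fun t j => if j < i then t j.castSucc
      else if j = i then signMax α (t i.castSucc) (t i.succ) else t j.succ, by
    refine continuous_pi fun j => ?_
    split_ifs
    · fun_prop
    · exact (continuous_signMax α).comp (f := fun t : Fin (_ + 1) → I => (t i.castSucc, t i.succ))
        (by fun_prop)
    · fun_prop⟩, by
    intro k t ht
    rcases signMax_mem α (t i.castSucc) (t i.succ) with h | h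
    · refine cubeFilt_of_injOn (t := t) (fun j => if j ≤ i then j.castSucc else j.succ) ?_ ?_ ht
      · intro j hj
        rcases lt_trichotomy j i with hji | rfl | hji
        · simpa [hji, hji.le] using hj
        · simpa [h] using hj
        · simpa [hji.not_gt, hji.ne', hji.not_ge] using hj
      · intro a _ b _ hab
        simp only [Fin.ext_iff, Fin.le_def] at hab ⊢
        split_ifs at hab <;> simp at hab <;> omega
    · refine cubeFilt_of_injOn (t := t) (fun j => if j < i then j.castSucc else j.succ) ?_ ?_ ht
      · intro j hj
        rcases lt_trichotomy j i with hji | rfl | hji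
        · simpa [hji] using hj
        · simpa [h] using hj
        · simpa [hji.not_gt, hji.ne'] using hj
      · intro a _ b _ hab
        simp only [Fin.ext_iff, Fin.lt_def] at hab ⊢
        split_ifs at hab <;> simp at hab <;> omega⟩

/-! ### Cubical sets with connections and cubical `ω`-groupoids -/

/-- A cubical set with connections.  Directions are numbered from `0`; the signs `-`, `+` are
`false`, `true`.  `face α i` is `∂ᵢ^α`, `degen i` is `εᵢ` and `conn α i` is `Γᵢ^α`. -/
structure ConnCubicalSet where
  /-- the set of `n`-cubes -/
  cell : ℕ → Type u
  face : ∀ {n : ℕ}, Bool → Fin (n + 1) → cell (n + 1) → cell n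
  degen : ∀ {n : ℕ}, Fin (n + 1) → cell n → cell (n + 1)
  conn : ∀ {n : ℕ}, Bool → Fin n → cell n → cell (n + 1)
  face_face : ∀ {n : ℕ} (α β : Bool) (i j : Fin (n + 1)), i ≤ j → ∀ x : cell (n + 2),
    face α i (face β j.succ x) = face β j (face α i.castSucc x)
  degen_degen : ∀ {n : ℕ} (i j : Fin (n + 1)), i ≤ j → ∀ x : cell n,
    degen i.castSucc (degen j x) = degen j.succ (degen i x)
  face_degen_self : ∀ {n : ℕ} (α : Bool) (i : Fin (n + 1)) (x : cell n), face α i (degen i x) = x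
  face_degen_lt : ∀ {n : ℕ} (α : Bool) (i j : Fin (n + 1)), i ≤ j → ∀ x : cell (n + 1),
    face α i.castSucc (degen j.succ x) = degen j (face α i x)
  face_degen_gt : ∀ {n : ℕ} (α : Bool) (i j : Fin (n + 1)), j ≤ i → ∀ x : cell (n + 1),
    face α i.succ (degen j.castSucc x) = degen j (face α i x)
  conn_conn_lt : ∀ {n : ℕ} (α β : Bool) (i j : Fin n), i < j → ∀ x : cell n,
    conn α i.castSucc (conn β j x) = conn β j.succ (conn α i x)
  conn_conn_self : ∀ {n : ℕ} (α : Bool) (i : Fin n) (x : cell n),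
    conn α i.castSucc (conn α i x) = conn α i.succ (conn α i x)
  conn_degen_lt : ∀ {n : ℕ} (α : Bool) (i : Fin n) (j : Fin (n + 1)), i.castSucc < j →
    ∀ x : cell n, conn α i.castSucc (degen j x) = degen j.succ (conn α i x)
  conn_degen_gt : ∀ {n : ℕ} (α : Bool) (i : Fin n) (j : Fin (n + 1)), j ≤ i.castSucc →
    ∀ x : cell n, conn α i.succ (degen j x) = degen j.castSucc (conn α i x)
  conn_degen_self : ∀ {n : ℕ} (α : Bool) (j : Fin (n + 1)) (x : cell n),
    conn α j (degen j x) = degen j.castSucc (degen j x)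
  face_conn_castSucc : ∀ {n : ℕ} (α : Bool) (j : Fin n) (x : cell n),
    face α j.castSucc (conn α j x) = x
  face_conn_succ : ∀ {n : ℕ} (α : Bool) (j : Fin n) (x : cell n),
    face α j.succ (conn α j x) = x
  face_conn_not_castSucc : ∀ {n : ℕ} (α : Bool) (j : Fin (n + 1)) (x : cell (n + 1)),
    face α j.castSucc (conn (!α) j x) = degen j (face α j x)
  face_conn_not_succ : ∀ {n : ℕ} (α : Bool) (j : Fin (n + 1)) (x : cell (n + 1)),
    face α j.succ (conn (!α) j x) = degen j (face α j x)
  face_conn_lt : ∀ {n : ℕ} (α β : Bool) (i : Fin (n + 1)) (j : Fin n), i ≤ j.castSucc →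
    ∀ x : cell (n + 1), face α i.castSucc (conn β j.succ x) = conn β j (face α i x)
  face_conn_gt : ∀ {n : ℕ} (α β : Bool) (i : Fin (n + 1)) (j : Fin n), j.castSucc < i →
    ∀ x : cell (n + 1), face α i.succ (conn β j.castSucc x) = conn β j (face α i x)

/-- The structure of a cubical `ω`-groupoid with connections on a cubical set with connections:
in each dimension and each direction `i` a groupoid structure, whose composition `a ∘ᵢ b` is
defined when `∂ᵢ⁺ a = ∂ᵢ⁻ b`, compatible with the faces, degeneracies and connections and with the
compositions in the other directions.  A law that involves compound composites includes the
assertion that these composites are defined. -/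
structure OmegaGroupoidStructure (K : ConnCubicalSet.{u}) where
  /-- the composition `a ∘ᵢ b` -/
  comp : ∀ {n : ℕ} (i : Fin (n + 1)) (a b : K.cell (n + 1)),
    K.face true i a = K.face false i b → K.cell (n + 1)
  /-- the inverse with respect to `∘ᵢ` -/
  inv : ∀ {n : ℕ}, Fin (n + 1) → K.cell (n + 1) → K.cell (n + 1)
  -- each composition is a groupoid composition
  face_false_comp : ∀ {n : ℕ} (i : Fin (n + 1)) (a b : K.cell (n + 1)) (h),
    K.face false i (comp i a b h) = K.face false i a
  face_true_comp : ∀ {n : ℕ} (i : Fin (n + 1)) (a b : K.cell (n + 1)) (h),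
    K.face true i (comp i a b h) = K.face true i b
  assoc : ∀ {n : ℕ} (i : Fin (n + 1)) (a b c : K.cell (n + 1)) (hab) (hbc), ∃ h₁ h₂,
    comp i (comp i a b hab) c h₁ = comp i a (comp i b c hbc) h₂
  degen_comp_self : ∀ {n : ℕ} (i : Fin (n + 1)) (a : K.cell (n + 1)), ∃ h,
    comp i (K.degen i (K.face false i a)) a h = a
  comp_degen_self : ∀ {n : ℕ} (i : Fin (n + 1)) (a : K.cell (n + 1)), ∃ h,
    comp i a (K.degen i (K.face true i a)) h = a
  comp_inv : ∀ {n : ℕ} (i : Fin (n + 1)) (a : K.cell (n + 1)), ∃ h,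
    comp i a (inv i a) h = K.degen i (K.face false i a)
  inv_comp : ∀ {n : ℕ} (i : Fin (n + 1)) (a : K.cell (n + 1)), ∃ h,
    comp i (inv i a) a h = K.degen i (K.face true i a)
  -- compatibility with faces and degeneracies in another direction; `i.succAbove j` is `j` if
  -- `j < i` and `j + 1` if `i ≤ j`
  face_comp : ∀ {n : ℕ} (α : Bool) (i : Fin (n + 2)) (j : Fin (n + 1)) (a b : K.cell (n + 2)) (h),
    ∃ h', K.face α i (comp (i.succAbove j) a b h) = comp j (K.face α i a) (K.face α i b) h'
  degen_comp : ∀ {n : ℕ} (i : Fin (n + 2)) (j : Fin (n + 1)) (a b : K.cell (n + 1)) (h),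
    ∃ h', K.degen i (comp j a b h) = comp (i.succAbove j) (K.degen i a) (K.degen i b) h'
  -- the interchange law
  interchange : ∀ {n : ℕ} (i j : Fin (n + 1)), i ≠ j → ∀ (a b c d : K.cell (n + 1))
    (hab : K.face true i a = K.face false i b) (hcd : K.face true i c = K.face false i d)
    (hac : K.face true j a = K.face false j c) (hbd : K.face true j b = K.face false j d),
    ∃ h₁ h₂, comp j (comp i a b hab) (comp i c d hcd) h₁ =
      comp i (comp j a c hac) (comp j b d hbd) h₂
  -- compatibility with connections; the last two are the transport laws
  conn_comp_lt : ∀ {n : ℕ} (α : Bool) (i j : Fin (n + 1)), i < j → ∀ (a b : K.cell (n + 1)) (h),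
    ∃ h', K.conn α i (comp j a b h) = comp j.succ (K.conn α i a) (K.conn α i b) h'
  conn_comp_gt : ∀ {n : ℕ} (α : Bool) (i j : Fin (n + 1)), j < i → ∀ (a b : K.cell (n + 1)) (h),
    ∃ h', K.conn α i (comp j a b h) = comp j.castSucc (K.conn α i a) (K.conn α i b) h'
  conn_false_comp : ∀ {n : ℕ} (j : Fin (n + 1)) (a b : K.cell (n + 1)) (h), ∃ h₁ h₂ h₃,
    K.conn false j (comp j a b h) =
      comp j.castSucc (comp j.succ (K.conn false j a) (K.degen j.castSucc b) h₁)
        (comp j.succ (K.degen j.succ b) (K.conn false j b) h₂) h₃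
  conn_true_comp : ∀ {n : ℕ} (j : Fin (n + 1)) (a b : K.cell (n + 1)) (h), ∃ h₁ h₂ h₃,
    K.conn true j (comp j a b h) =
      comp j.castSucc (comp j.succ (K.conn true j a) (K.degen j.succ a) h₁)
        (comp j.succ (K.degen j.castSucc a) (K.conn true j b) h₂) h₃
  -- the two connections are mutually inverse
  conn_comp_conn_castSucc : ∀ {n : ℕ} (i : Fin (n + 1)) (a : K.cell (n + 1)), ∃ h,
    comp i.castSucc (K.conn true i a) (K.conn false i a) h = K.degen i.succ a
  conn_comp_conn_succ : ∀ {n : ℕ} (i : Fin (n + 1)) (a : K.cell (n + 1)), ∃ h,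
    comp i.succ (K.conn true i a) (K.conn false i a) h = K.degen i.castSucc a

/-! ### Coordinates of the structure maps of the cubes -/

theorem coface_apply {n : ℕ} (α : Bool) (i : Fin (n + 1)) (t : Fin n → I) (l : Fin (n + 1)) :
    coface α i t l = if h : l.1 < i.1 then t ⟨l.1, by omega⟩
      else if h' : l.1 = i.1 then endpoint α else t ⟨l.1 - 1, by omega⟩ := by
  change (i.insertNth (endpoint α) t : Fin (n + 1) → I) l = _
  rcases Fin.eq_self_or_eq_succAbove i l with rfl | ⟨m, rfl⟩
  · simp
  · rw [Fin.insertNth_apply_succAbove]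
    rcases lt_or_ge m.castSucc i with h | h
    · have h' : m.1 < i.1 := h
      simp [Fin.succAbove_of_castSucc_lt _ _ h, h']
    · have h' : i.1 ≤ m.1 := h
      have h1 : ¬ m.1 + 1 < i.1 := by omega
      have h2 : ¬ m.1 + 1 = i.1 := by omega
      simp [Fin.succAbove_of_le_castSucc _ _ h, h1, h2]

theorem codegen_apply {n : ℕ} (i : Fin (n + 1)) (t : Fin (n + 1) → I) (l : Fin n) :
    codegen i t l = if l.1 < i.1 then t ⟨l.1, by omega⟩ else t ⟨l.1 + 1, by omega⟩ := by
  change t (i.succAbove l) = _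
  rcases lt_or_ge l.castSucc i with h | h
  · have h' : l.1 < i.1 := h
    rw [Fin.succAbove_of_castSucc_lt _ _ h, if_pos h']; rfl
  · have h' : ¬ l.1 < i.1 := not_lt.2 h
    rw [Fin.succAbove_of_le_castSucc _ _ h, if_neg h']; rfl

theorem coconn_apply {n : ℕ} (α : Bool) (i : Fin n) (t : Fin (n + 1) → I) (l : Fin n) :
    coconn α i t l = if l.1 < i.1 then t ⟨l.1, by omega⟩
      else if l.1 = i.1 then signMax α (t ⟨i.1, by omega⟩) (t ⟨i.1 + 1, by omega⟩)
      else t ⟨l.1 + 1, by omega⟩ := by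
  change (if l < i then _ else if l = i then _ else _) = _
  simp only [Fin.lt_def, Fin.ext_iff]
  rfl

theorem signMax_self (α : Bool) (s : I) : signMax α s s = s := by
  cases α <;> simp [signMax]

theorem signMax_assoc (α : Bool) (r s t : I) :
    signMax α (signMax α r s) t = signMax α r (signMax α s t) := by
  cases α <;> simp [signMax, max_assoc, min_assoc]

theorem signMax_endpoint_left (α : Bool) (s : I) : signMax α (endpoint α) s = s := by
  cases α <;> simp [signMax, endpoint, unitInterval.le_one']

theorem signMax_endpoint_right (α : Bool) (s : I) : signMax α s (endpoint α) = s := by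
  cases α <;> simp [signMax, endpoint, unitInterval.le_one']

theorem signMax_not_endpoint_left (α : Bool) (s : I) :
    signMax (!α) (endpoint α) s = endpoint α := by
  cases α <;> simp [signMax, endpoint, unitInterval.le_one']

theorem signMax_not_endpoint_right (α : Bool) (s : I) :
    signMax (!α) s (endpoint α) = endpoint α := by
  cases α <;> simp [signMax, endpoint, unitInterval.le_one']

/-! ### The singular cubical set `R(X_*)` of a filtered space -/

set_option linter.unusedSimpArgs false in
/-- The singular cubical set with connections `R(X_*)`: its `n`-cubes are the filtered maps from
the `n`-cube to `X_*`, and its faces, degeneracies and connections are given by precomposition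
with the structure maps of the cubes. -/
def singularCubes {X : Type u} [TopologicalSpace X] (F : FilteredSpace X) :
    ConnCubicalSet.{u} where
  cell n := FilteredMap (cubeFilt n) F
  face α i x := x.comp (coface α i)
  degen i x := x.comp (codegen i)
  conn α i x := x.comp (coconn α i)
  face_face α β i j h x := by
    refine FilteredMap.ext fun t => congrArg x.1 (funext fun l => ?_)
    obtain ⟨l, hl⟩ := l
    simp only [coface_apply, codegen_apply, coconn_apply, Fin.val_castSucc, Fin.val_succ,
      Fin.le_def, Fin.lt_def] at *
    grind [signMax_self, signMax_assoc, signMax_endpoint_left, signMax_endpoint_right,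
      signMax_not_endpoint_left, signMax_not_endpoint_right]
  degen_degen i j h x := by
    refine FilteredMap.ext fun t => congrArg x.1 (funext fun l => ?_)
    obtain ⟨l, hl⟩ := l
    simp only [coface_apply, codegen_apply, coconn_apply, Fin.val_castSucc, Fin.val_succ,
      Fin.le_def, Fin.lt_def] at *
    grind [signMax_self, signMax_assoc, signMax_endpoint_left, signMax_endpoint_right,
      signMax_not_endpoint_left, signMax_not_endpoint_right]
  face_degen_self α i x := by
    refine FilteredMap.ext fun t => congrArg x.1 (funext fun l => ?_)
    obtain ⟨l, hl⟩ := l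
    simp only [coface_apply, codegen_apply, coconn_apply, Fin.val_castSucc, Fin.val_succ,
      Fin.le_def, Fin.lt_def] at *
    grind [signMax_self, signMax_assoc, signMax_endpoint_left, signMax_endpoint_right,
      signMax_not_endpoint_left, signMax_not_endpoint_right]
  face_degen_lt α i j h x := by
    refine FilteredMap.ext fun t => congrArg x.1 (funext fun l => ?_)
    obtain ⟨l, hl⟩ := l
    simp only [coface_apply, codegen_apply, coconn_apply, Fin.val_castSucc, Fin.val_succ,
      Fin.le_def, Fin.lt_def] at *
    grind [signMax_self, signMax_assoc, signMax_endpoint_left, signMax_endpoint_right,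
      signMax_not_endpoint_left, signMax_not_endpoint_right]
  face_degen_gt α i j h x := by
    refine FilteredMap.ext fun t => congrArg x.1 (funext fun l => ?_)
    obtain ⟨l, hl⟩ := l
    simp only [coface_apply, codegen_apply, coconn_apply, Fin.val_castSucc, Fin.val_succ,
      Fin.le_def, Fin.lt_def] at *
    grind [signMax_self, signMax_assoc, signMax_endpoint_left, signMax_endpoint_right,
      signMax_not_endpoint_left, signMax_not_endpoint_right]
  conn_conn_lt α β i j h x := by
    refine FilteredMap.ext fun t => congrArg x.1 (funext fun l => ?_)
    obtain ⟨l, hl⟩ := l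
    simp only [coface_apply, codegen_apply, coconn_apply, Fin.val_castSucc, Fin.val_succ,
      Fin.le_def, Fin.lt_def] at *
    grind [signMax_self, signMax_assoc, signMax_endpoint_left, signMax_endpoint_right,
      signMax_not_endpoint_left, signMax_not_endpoint_right]
  conn_conn_self α i x := by
    refine FilteredMap.ext fun t => congrArg x.1 (funext fun l => ?_)
    obtain ⟨l, hl⟩ := l
    simp only [coface_apply, codegen_apply, coconn_apply, Fin.val_castSucc, Fin.val_succ,
      Fin.le_def, Fin.lt_def] at *
    grind [signMax_self, signMax_assoc, signMax_endpoint_left, signMax_endpoint_right,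
      signMax_not_endpoint_left, signMax_not_endpoint_right]
  conn_degen_lt α i j h x := by
    refine FilteredMap.ext fun t => congrArg x.1 (funext fun l => ?_)
    obtain ⟨l, hl⟩ := l
    simp only [coface_apply, codegen_apply, coconn_apply, Fin.val_castSucc, Fin.val_succ,
      Fin.le_def, Fin.lt_def] at *
    grind [signMax_self, signMax_assoc, signMax_endpoint_left, signMax_endpoint_right,
      signMax_not_endpoint_left, signMax_not_endpoint_right]
  conn_degen_gt α i j h x := by
    refine FilteredMap.ext fun t => congrArg x.1 (funext fun l => ?_)
    obtain ⟨l, hl⟩ := l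
    simp only [coface_apply, codegen_apply, coconn_apply, Fin.val_castSucc, Fin.val_succ,
      Fin.le_def, Fin.lt_def] at *
    grind [signMax_self, signMax_assoc, signMax_endpoint_left, signMax_endpoint_right,
      signMax_not_endpoint_left, signMax_not_endpoint_right]
  conn_degen_self α j x := by
    refine FilteredMap.ext fun t => congrArg x.1 (funext fun l => ?_)
    obtain ⟨l, hl⟩ := l
    simp only [coface_apply, codegen_apply, coconn_apply, Fin.val_castSucc, Fin.val_succ,
      Fin.le_def, Fin.lt_def] at *
    grind [signMax_self, signMax_assoc, signMax_endpoint_left, signMax_endpoint_right,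
      signMax_not_endpoint_left, signMax_not_endpoint_right]
  face_conn_castSucc α j x := by
    refine FilteredMap.ext fun t => congrArg x.1 (funext fun l => ?_)
    obtain ⟨l, hl⟩ := l
    simp only [coface_apply, codegen_apply, coconn_apply, Fin.val_castSucc, Fin.val_succ,
      Fin.le_def, Fin.lt_def] at *
    grind [signMax_self, signMax_assoc, signMax_endpoint_left, signMax_endpoint_right,
      signMax_not_endpoint_left, signMax_not_endpoint_right]
  face_conn_succ α j x := by
    refine FilteredMap.ext fun t => congrArg x.1 (funext fun l => ?_)
    obtain ⟨l, hl⟩ := l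
    simp only [coface_apply, codegen_apply, coconn_apply, Fin.val_castSucc, Fin.val_succ,
      Fin.le_def, Fin.lt_def] at *
    grind [signMax_self, signMax_assoc, signMax_endpoint_left, signMax_endpoint_right,
      signMax_not_endpoint_left, signMax_not_endpoint_right]
  face_conn_not_castSucc α j x := by
    refine FilteredMap.ext fun t => congrArg x.1 (funext fun l => ?_)
    obtain ⟨l, hl⟩ := l
    simp only [coface_apply, codegen_apply, coconn_apply, Fin.val_castSucc, Fin.val_succ,
      Fin.le_def, Fin.lt_def] at *
    grind [signMax_self, signMax_assoc, signMax_endpoint_left, signMax_endpoint_right,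
      signMax_not_endpoint_left, signMax_not_endpoint_right]
  face_conn_not_succ α j x := by
    refine FilteredMap.ext fun t => congrArg x.1 (funext fun l => ?_)
    obtain ⟨l, hl⟩ := l
    simp only [coface_apply, codegen_apply, coconn_apply, Fin.val_castSucc, Fin.val_succ,
      Fin.le_def, Fin.lt_def] at *
    grind [signMax_self, signMax_assoc, signMax_endpoint_left, signMax_endpoint_right,
      signMax_not_endpoint_left, signMax_not_endpoint_right]
  face_conn_lt α β i j h x := by
    refine FilteredMap.ext fun t => congrArg x.1 (funext fun l => ?_)
    obtain ⟨l, hl⟩ := l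
    simp only [coface_apply, codegen_apply, coconn_apply, Fin.val_castSucc, Fin.val_succ,
      Fin.le_def, Fin.lt_def] at *
    grind [signMax_self, signMax_assoc, signMax_endpoint_left, signMax_endpoint_right,
      signMax_not_endpoint_left, signMax_not_endpoint_right]
  face_conn_gt α β i j h x := by
    refine FilteredMap.ext fun t => congrArg x.1 (funext fun l => ?_)
    obtain ⟨l, hl⟩ := l
    simp only [coface_apply, codegen_apply, coconn_apply, Fin.val_castSucc, Fin.val_succ,
      Fin.le_def, Fin.lt_def] at *
    grind [signMax_self, signMax_assoc, signMax_endpoint_left, signMax_endpoint_right,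
      signMax_not_endpoint_left, signMax_not_endpoint_right]

/-- The map `s ↦ 2s` on `[0, 1/2]` (truncated to the unit interval elsewhere). -/
noncomputable def firstHalf (s : I) : I := Set.projIcc 0 1 zero_le_one (2 * (s : ℝ))

/-- The map `s ↦ 2s - 1` on `[1/2, 1]` (truncated to the unit interval elsewhere). -/
noncomputable def secondHalf (s : I) : I := Set.projIcc 0 1 zero_le_one (2 * (s : ℝ) - 1)

theorem update_eq_coface {n : ℕ} (α : Bool) (i : Fin (n + 1)) (t : Fin (n + 1) → I) :
    Function.update t i (endpoint α) = coface α i (fun j => t (i.succAbove j)) := by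
  change _ = (i.insertNth (endpoint α) (fun j => t (i.succAbove j)) : Fin (n + 1) → I)
  exact (Fin.insertNth_removeNth i (endpoint α) t).symm

theorem update_mem_cubeFilt {n : ℕ} (i : Fin n) {t : Fin n → I} {s : I}
    (hs : t i = 0 ∨ t i = 1 → s = 0 ∨ s = 1) {k : ℕ} (ht : t ∈ (cubeFilt n).filt k) :
    Function.update t i s ∈ (cubeFilt n).filt k := by
  refine cubeFilt_of_injOn id (fun j hj => ?_) (Set.injOn_id _) ht
  by_cases hji : j = i
  · subst hji
    rw [Function.update_self] at hj
    simp only [id]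
    tauto
  · rwa [Function.update_of_ne hji] at hj

/-- The standard partial composition `a ∘ᵢ b` of cubes in `R(X_*)`, for `∂ᵢ⁺ a = ∂ᵢ⁻ b`. -/
noncomputable def cubeComp {X : Type u} [TopologicalSpace X] {F : FilteredSpace X} {n : ℕ}
    (i : Fin (n + 1)) (a b : (singularCubes F).cell (n + 1))
    (h : (singularCubes F).face true i a = (singularCubes F).face false i b) :
    (singularCubes F).cell (n + 1) :=
  ⟨⟨fun t => if (t i : ℝ) ≤ 1 / 2 then a.1 (Function.update t i (firstHalf (t i)))
      else b.1 (Function.update t i (secondHalf (t i))), by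
    have h1 : Continuous firstHalf := by unfold firstHalf; fun_prop
    have h2 : Continuous secondHalf := by unfold secondHalf; fun_prop
    refine Continuous.if_le ?_ ?_ (by fun_prop) (by fun_prop) fun t ht => ?_
    · exact a.1.continuous.comp
        (continuous_id.update i (h1.comp (continuous_apply i)))
    · exact b.1.continuous.comp
        (continuous_id.update i (h2.comp (continuous_apply i)))
    · have e1 : firstHalf (t i) = endpoint true := by
        simp [firstHalf, endpoint, ht]
      have e2 : secondHalf (t i) = endpoint false := by
        simp [secondHalf, endpoint, ht]
      rw [e1, e2, update_eq_coface, update_eq_coface]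
      exact congrArg (fun f : FilteredMap (cubeFilt n) F => f fun j => t (i.succAbove j)) h⟩, by
    intro k t ht
    change (if (t i : ℝ) ≤ 1 / 2 then a.1 (Function.update t i (firstHalf (t i)))
      else b.1 (Function.update t i (secondHalf (t i)))) ∈ F.filt k
    split_ifs with hti
    · refine a.2 k _ (update_mem_cubeFilt i ?_ ht)
      rintro (h0 | h0)
      · left; simp [firstHalf, h0]
      · rw [h0] at hti; norm_num at hti
    · refine b.2 k _ (update_mem_cubeFilt i ?_ ht)
      rintro (h0 | h0)
      · rw [h0] at hti; norm_num at hti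
      · right; rw [h0]; norm_num [secondHalf]⟩

/-! ### The quotient `ϱ(X_*)` -/

/-- Filtered homotopy rel vertices of filtered maps `a, b` from the `n`-cube to `X_*`: a homotopy
from `a` to `b` through filtered maps which is constant on each vertex of the cube, that is on
the `0`-skeleton. -/
def FilteredHomotopic {X : Type u} [TopologicalSpace X] {F : FilteredSpace X} {n : ℕ}
    (a b : (singularCubes F).cell n) : Prop :=
  ContinuousMap.HomotopicWith a.1 b.1 fun f =>
    IsFilteredMap (cubeFilt n) F f ∧ ∀ v ∈ (cubeFilt n).filt 0, f v = a.1 v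

theorem FilteredHomotopic.vertex {X : Type u} [TopologicalSpace X] {F : FilteredSpace X} {n : ℕ}
    {a b : (singularCubes F).cell n} (h : FilteredHomotopic a b) {v : Fin n → I}
    (hv : v ∈ (cubeFilt n).filt 0) : b.1 v = a.1 v := by
  obtain ⟨H⟩ := h
  have := (H.prop 1).2 v hv
  simpa using this

/-- Filtered homotopy rel vertices is an equivalence relation. -/
def cubeSetoid {X : Type u} [TopologicalSpace X] (F : FilteredSpace X) (n : ℕ) :
    Setoid ((singularCubes F).cell n) where
  r := FilteredHomotopic
  iseqv :=
    { refl := fun a => ContinuousMap.HomotopicWith.refl a.1 ⟨a.2, fun _ _ => rfl⟩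
      symm := fun {a b} h => by
        have hv := fun v (hv : v ∈ (cubeFilt n).filt 0) => h.vertex hv
        obtain ⟨H⟩ := h
        exact ⟨{ H.symm.toHomotopy with
          prop' := fun t => ⟨(H.symm.prop t).1, fun v h0 =>
            ((H.symm.prop t).2 v h0).trans (hv v h0).symm⟩ }⟩
      trans := fun {a b c} h h' => by
        have hv := fun v (hv : v ∈ (cubeFilt n).filt 0) => h.vertex hv
        obtain ⟨H'⟩ := h'
        exact h.trans ⟨{ H'.toHomotopy with
          prop' := fun t => ⟨(H'.prop t).1, fun v h0 =>
            ((H'.prop t).2 v h0).trans (hv v h0)⟩ }⟩ }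

theorem FilteredHomotopic.precomp {X : Type u} [TopologicalSpace X] {F : FilteredSpace X}
    {m n : ℕ} {a b : (singularCubes F).cell n} (h : FilteredHomotopic a b)
    (f : FilteredMap (cubeFilt m) (cubeFilt n)) :
    FilteredHomotopic (F := F) (FilteredMap.comp a f) (FilteredMap.comp b f) := by
  obtain ⟨H⟩ := h
  exact ⟨{
    toFun := fun p => H (p.1, f.1 p.2)
    continuous_toFun := by fun_prop
    map_zero_left := fun x => H.map_zero_left _
    map_one_left := fun x => H.map_one_left _
    prop' := fun t => ⟨fun k x hx => (H.prop t).1 k _ (f.2 k x hx),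
      fun v hv => (H.prop t).2 _ (f.2 0 v hv)⟩ }⟩

/-- Precomposition of classes of cubes with a filtered map of cubes. -/
def classPrecomp {X : Type u} [TopologicalSpace X] {F : FilteredSpace X} {m n : ℕ}
    (f : FilteredMap (cubeFilt m) (cubeFilt n)) :
    Quotient (cubeSetoid F n) → Quotient (cubeSetoid F m) :=
  Quotient.map (fun a => FilteredMap.comp a f) fun _ _ h => FilteredHomotopic.precomp h f

/-- The quotient `ϱ(X_*)` of `R(X_*)` by filtered homotopy rel vertices, with the induced faces,
degeneracies and connections. -/
def rho {X : Type u} [TopologicalSpace X] (F : FilteredSpace X) : ConnCubicalSet.{u} where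
  cell n := Quotient (cubeSetoid F n)
  face α i := classPrecomp (coface α i)
  degen i := classPrecomp (codegen i)
  conn α i := classPrecomp (coconn α i)
  face_face α β i j h := Quotient.ind fun x => congrArg (Quotient.mk _) ((singularCubes F).face_face α β i j h x)
  degen_degen i j h := Quotient.ind fun x => congrArg (Quotient.mk _) ((singularCubes F).degen_degen i j h x)
  face_degen_self α i := Quotient.ind fun x => congrArg (Quotient.mk _) ((singularCubes F).face_degen_self α i x)
  face_degen_lt α i j h := Quotient.ind fun x => congrArg (Quotient.mk _) ((singularCubes F).face_degen_lt α i j h x)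
  face_degen_gt α i j h := Quotient.ind fun x => congrArg (Quotient.mk _) ((singularCubes F).face_degen_gt α i j h x)
  conn_conn_lt α β i j h := Quotient.ind fun x => congrArg (Quotient.mk _) ((singularCubes F).conn_conn_lt α β i j h x)
  conn_conn_self α i := Quotient.ind fun x => congrArg (Quotient.mk _) ((singularCubes F).conn_conn_self α i x)
  conn_degen_lt α i j h := Quotient.ind fun x => congrArg (Quotient.mk _) ((singularCubes F).conn_degen_lt α i j h x)
  conn_degen_gt α i j h := Quotient.ind fun x => congrArg (Quotient.mk _) ((singularCubes F).conn_degen_gt α i j h x)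
  conn_degen_self α j := Quotient.ind fun x => congrArg (Quotient.mk _) ((singularCubes F).conn_degen_self α j x)
  face_conn_castSucc α j := Quotient.ind fun x => congrArg (Quotient.mk _) ((singularCubes F).face_conn_castSucc α j x)
  face_conn_succ α j := Quotient.ind fun x => congrArg (Quotient.mk _) ((singularCubes F).face_conn_succ α j x)
  face_conn_not_castSucc α j := Quotient.ind fun x => congrArg (Quotient.mk _) ((singularCubes F).face_conn_not_castSucc α j x)
  face_conn_not_succ α j := Quotient.ind fun x => congrArg (Quotient.mk _) ((singularCubes F).face_conn_not_succ α j x)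
  face_conn_lt α β i j h := Quotient.ind fun x => congrArg (Quotient.mk _) ((singularCubes F).face_conn_lt α β i j h x)
  face_conn_gt α β i j h := Quotient.ind fun x => congrArg (Quotient.mk _) ((singularCubes F).face_conn_gt α β i j h x)

/-- The quotient map `R(X_*) → ϱ(X_*)`. -/
def toRho {X : Type u} [TopologicalSpace X] (F : FilteredSpace X) {n : ℕ}
    (a : (singularCubes F).cell n) : (rho F).cell n :=
  Quotient.mk (cubeSetoid F n) a

/-! Homotopies in `ϱ` fix only the vertices, so two homotopies need not agree on the face along
which their cubes are to be composed. Everything rests on repairing such mismatches.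

A homotopy of `n`-cubes rel vertices can be read as an `(n+1)`-cube, `thin`. Squeezing its time
interval deforms it to a degenerate cube, so composing it with a matching cube `b` does not change
the class of `b` (`thin_cubeComp`) but does change its first face. This is homotopy extension and
gives part 1 (`exists_homRel_face_eq`).

The crucial lemma is `HomRel.rel_face`: if two homotopic cubes have the same first face, the
homotopy can be chosen fixed on that face. The face contracts to a vertex through the filtered map
`cone`. Preceding a cube by the reversed cone and then the cone of its face changes nothing up to
homotopy. During a homotopy the second cone can follow the moving face while the first stays put,
because the two meet in a face that is constant at the image of a vertex, which does not move.

For part 2, let `A t` run from `a` to `a'`, and insert between `A t` and `b` the trace of the moving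
face back to its initial position. This gives a homotopy of composites; at both ends
`HomRel.rel_face` replaces the second factor by `b` and by `b'` relative to the joint face.

For part 3, compatibility with faces, degeneracies and connections, as well as interchange, holds
strictly for singular cubes once all the composites exist. The groupoid laws and the cancellation of
the connections are reparametrisations of one coordinate (`homRel_of_update`). Interchange also
needs four representatives matching along all four common faces; `exists_square_reps` finds them,
again through `HomRel.rel_face`. Uniqueness follows from part 1, since composition determines
inverses. -/

namespace FilteredCube

variable {X : Type u} [TopologicalSpace X] {F : FilteredSpace X} {n : ℕ}

/-! ### Cubes and their faces -/

theorem cell_ext {a b : (singularCubes F).cell n} (h : ∀ t, a.1 t = b.1 t) : a = b :=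
  FilteredMap.ext h

theorem mem_cubeFilt_zero {t : Fin n → I} :
    t ∈ (cubeFilt n).filt 0 ↔ ∀ i, t i = 0 ∨ t i = 1 := by
  change Set.ncard _ ≤ 0 ↔ _
  rw [Nat.le_zero, Set.ncard_eq_zero (Set.toFinite _), Set.eq_empty_iff_forall_notMem]
  refine forall_congr' fun i => ?_
  simp only [Set.mem_ofPred_eq]
  tauto

theorem face_apply (α : Bool) (i : Fin (n + 1)) (a : (singularCubes F).cell (n + 1))
    (t : Fin n → I) : ((singularCubes F).face α i a).1 t = a.1 (coface α i t) := rfl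

theorem degen_apply (i : Fin (n + 1)) (a : (singularCubes F).cell n) (t : Fin (n + 1) → I) :
    ((singularCubes F).degen i a).1 t = a.1 (codegen i t) := rfl

theorem conn_apply (α : Bool) (i : Fin n) (a : (singularCubes F).cell n) (t : Fin (n + 1) → I) :
    ((singularCubes F).conn α i a).1 t = a.1 (coconn α i t) := rfl

theorem face_codegen (α : Bool) (i : Fin (n + 1)) (a : (singularCubes F).cell (n + 1))
    (t : Fin (n + 1) → I) : ((singularCubes F).face α i a).1 (codegen i t) =
      a.1 (Function.update t i (endpoint α)) := by
  rw [update_eq_coface]; rfl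

theorem codegen_coface (α : Bool) (i : Fin (n + 1)) (t : Fin n → I) :
    codegen i (coface α i t) = t :=
  funext fun l => Fin.insertNth_apply_succAbove (α := fun _ => I) i (endpoint α) t l

theorem coface_self (α : Bool) (i : Fin (n + 1)) (t : Fin n → I) :
    coface α i t i = endpoint α :=
  Fin.insertNth_apply_same (α := fun _ => I) i (endpoint α) t

/-- Every point of the face is obtained by overwriting the `i`-th coordinate of a point of the large
cube, so matching of faces can be tested without leaving that cube. -/
theorem face_eq_iff {α β : Bool} {i : Fin (n + 1)} {a b : (singularCubes F).cell (n + 1)} :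
    (singularCubes F).face α i a = (singularCubes F).face β i b ↔
      ∀ t, a.1 (Function.update t i (endpoint α)) = b.1 (Function.update t i (endpoint β)) := by
  refine ⟨fun h t => ?_, fun h => cell_ext fun t => ?_⟩
  · rw [← face_codegen, h, face_codegen]
  · have := h (coface α i t)
    rwa [← face_codegen, ← face_codegen, codegen_coface] at this

theorem face_eq_of {α : Bool} {i : Fin (n + 1)} {a b : (singularCubes F).cell (n + 1)}
    (h : ∀ t, t i = endpoint α → a.1 t = b.1 t) :
    (singularCubes F).face α i a = (singularCubes F).face α i b :=
  face_eq_iff.2 fun _ => h _ (Function.update_self ..)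

/-! ### The two halves of the interval -/

theorem continuous_firstHalf : Continuous firstHalf := by unfold firstHalf; fun_prop

theorem continuous_secondHalf : Continuous secondHalf := by unfold secondHalf; fun_prop

theorem firstHalf_zero : firstHalf 0 = 0 := by simp [firstHalf]

theorem firstHalf_eq_one {s : I} (h : 1 / 2 ≤ (s : ℝ)) : firstHalf s = 1 :=
  Set.projIcc_of_right_le _ (by linarith)

theorem secondHalf_one : secondHalf 1 = 1 := by
  simp only [secondHalf]; exact Set.projIcc_of_right_le _ (by norm_num)

theorem secondHalf_eq_zero {s : I} (h : (s : ℝ) ≤ 1 / 2) : secondHalf s = 0 :=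
  Set.projIcc_of_le_left _ (by linarith)

theorem coe_projIcc (r : ℝ) : ((Set.projIcc (0 : ℝ) 1 zero_le_one r : I) : ℝ) = max 0 (min 1 r) :=
  Set.coe_projIcc ..

theorem coe_firstHalf (s : I) : (firstHalf s : ℝ) = min 1 (2 * (s : ℝ)) := by
  rw [firstHalf, coe_projIcc, max_eq_right]
  exact le_min zero_le_one (by linarith [s.2.1])

theorem coe_secondHalf (s : I) : (secondHalf s : ℝ) = max 0 (2 * (s : ℝ) - 1) := by
  rw [secondHalf, coe_projIcc, min_eq_right]
  linarith [s.2.2]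

theorem cubeComp_apply (i : Fin (n + 1)) (a b : (singularCubes F).cell (n + 1)) (h)
    (t : Fin (n + 1) → I) : (cubeComp i a b h).1 t =
      if (t i : ℝ) ≤ 1 / 2 then a.1 (Function.update t i (firstHalf (t i)))
      else b.1 (Function.update t i (secondHalf (t i))) := rfl

theorem cubeComp_apply_of_ge (i : Fin (n + 1)) (a b : (singularCubes F).cell (n + 1)) (h)
    (t : Fin (n + 1) → I) (ht : 1 / 2 ≤ (t i : ℝ)) :
    (cubeComp i a b h).1 t = b.1 (Function.update t i (secondHalf (t i))) := by
  rw [cubeComp_apply]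
  split_ifs with h'
  · rw [firstHalf_eq_one ht, secondHalf_eq_zero h']
    exact face_eq_iff.1 h t
  · rfl

theorem cubeComp_apply_zero {i : Fin (n + 1)} {a b : (singularCubes F).cell (n + 1)} {h}
    {t : Fin (n + 1) → I} (ht : t i = 0) : (cubeComp i a b h).1 t = a.1 t := by
  rw [cubeComp_apply, if_pos (by rw [ht]; norm_num), ht, firstHalf_zero, ← ht,
    Function.update_eq_self]

theorem cubeComp_apply_one {i : Fin (n + 1)} {a b : (singularCubes F).cell (n + 1)} {h}
    {t : Fin (n + 1) → I} (ht : t i = 1) : (cubeComp i a b h).1 t = b.1 t := by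
  rw [cubeComp_apply_of_ge _ _ _ _ _ (by rw [ht]; norm_num), ht, secondHalf_one, ← ht,
    Function.update_eq_self]

theorem face_false_cubeComp (i : Fin (n + 1)) (a b : (singularCubes F).cell (n + 1)) (h) :
    (singularCubes F).face false i (cubeComp i a b h) = (singularCubes F).face false i a :=
  face_eq_of fun _ ht => cubeComp_apply_zero ht

theorem face_true_cubeComp (i : Fin (n + 1)) (a b : (singularCubes F).cell (n + 1)) (h) :
    (singularCubes F).face true i (cubeComp i a b h) = (singularCubes F).face true i b :=
  face_eq_of fun _ ht => cubeComp_apply_one ht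

/-! ### Filtered homotopies fixed on a set of points -/

/-- Homotopy through filtered maps which is fixed on the set `S`. -/
def HomRel (S : Set (Fin n → I)) (a b : (singularCubes F).cell n) : Prop :=
  ContinuousMap.HomotopicWith a.1 b.1 fun f =>
    IsFilteredMap (cubeFilt n) F f ∧ ∀ v ∈ S, f v = a.1 v

/-- Joint continuity of a family of cubes. -/
def ContFamily {T : Type*} [TopologicalSpace T] (A : T → (singularCubes F).cell n) : Prop :=
  Continuous fun p : T × (Fin n → I) => (A p.1).1 p.2

theorem HomRel.of_path {S : Set (Fin n → I)} {A : I → (singularCubes F).cell n}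
    (hA : ContFamily A) (hS : ∀ t, ∀ v ∈ S, (A t).1 v = (A 0).1 v) : HomRel S (A 0) (A 1) :=
  ⟨{ toFun := fun p => (A p.1).1 p.2
     continuous_toFun := hA
     map_zero_left := fun _ => rfl
     map_one_left := fun _ => rfl
     prop' := fun t => ⟨(A t).2, hS t⟩ }⟩

/-- Handling a homotopy as a path of cubes lets faces, cones and composites be formed at each time
separately, with only joint continuity left to check. -/
theorem HomRel.path {S : Set (Fin n → I)} {a b : (singularCubes F).cell n} (h : HomRel S a b) :
    ∃ A : I → (singularCubes F).cell n, ContFamily A ∧ A 0 = a ∧ A 1 = b ∧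
      ∀ t, ∀ v ∈ S, (A t).1 v = a.1 v := by
  obtain ⟨H⟩ := h
  refine ⟨fun t => ⟨H.toHomotopy.curry t, (H.prop t).1⟩, H.continuous, ?_, ?_, fun t =>
    (H.prop t).2⟩
  · exact cell_ext fun t => H.map_zero_left t
  · exact cell_ext fun t => H.map_one_left t

theorem HomRel.eq_on {S : Set (Fin n → I)} {a b : (singularCubes F).cell n} (h : HomRel S a b)
    {v} (hv : v ∈ S) : b.1 v = a.1 v := by
  obtain ⟨A, -, -, rfl, hS⟩ := h.path
  exact hS 1 v hv

theorem HomRel.refl (S : Set (Fin n → I)) (a : (singularCubes F).cell n) : HomRel S a a :=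
  ContinuousMap.HomotopicWith.refl a.1 ⟨a.2, fun _ _ => rfl⟩

theorem HomRel.symm {S : Set (Fin n → I)} {a b : (singularCubes F).cell n} (h : HomRel S a b) :
    HomRel S b a := by
  have hv := fun v (hv : v ∈ S) => h.eq_on hv
  obtain ⟨H⟩ := h
  exact ⟨{ H.symm.toHomotopy with
    prop' := fun t => ⟨(H.symm.prop t).1, fun v h0 =>
      ((H.symm.prop t).2 v h0).trans (hv v h0).symm⟩ }⟩

theorem HomRel.trans {S : Set (Fin n → I)} {a b c : (singularCubes F).cell n}
    (h : HomRel S a b) (h' : HomRel S b c) : HomRel S a c := by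
  have hv := fun v (hv : v ∈ S) => h.eq_on hv
  obtain ⟨H'⟩ := h'
  exact ContinuousMap.HomotopicWith.trans h ⟨{ H'.toHomotopy with
    prop' := fun t => ⟨(H'.prop t).1, fun v h0 =>
      ((H'.prop t).2 v h0).trans (hv v h0)⟩ }⟩

theorem HomRel.mono {S T : Set (Fin n → I)} {a b : (singularCubes F).cell n} (h : HomRel S a b)
    (hT : T ⊆ S) : HomRel T a b := by
  obtain ⟨A, hA, rfl, rfl, hS⟩ := h.path
  exact .of_path hA fun t v hv => hS t v (hT hv)

/-- The two opposite faces of the cube in the direction `i`. -/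
def ends (i : Fin n) : Set (Fin n → I) := {t | t i = 0 ∨ t i = 1}

/-- The face `tᵢ = 0` or `tᵢ = 1` of the cube, together with all vertices. -/
def faceVert (α : Bool) (i : Fin n) : Set (Fin n → I) :=
  (cubeFilt n).filt 0 ∪ {t | t i = endpoint α}

theorem filt_zero_subset_ends (i : Fin n) : (cubeFilt n).filt 0 ⊆ ends i :=
  fun _ ht => mem_cubeFilt_zero.1 ht i

theorem filt_zero_subset_faceVert (α : Bool) (i : Fin n) :
    (cubeFilt n).filt 0 ⊆ faceVert α i := Set.subset_union_left

theorem faceVert_subset_ends (α : Bool) (i : Fin n) : faceVert α i ⊆ ends i := by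
  refine Set.union_subset (filt_zero_subset_ends i) fun t ht => ?_
  cases α
  · exact Or.inl ht
  · exact Or.inr ht

theorem HomRel.of_ends {i : Fin n} {a b : (singularCubes F).cell n} (h : HomRel (ends i) a b) :
    HomRel ((cubeFilt n).filt 0) a b := h.mono (filt_zero_subset_ends i)

/-! ### Pasting homotopies -/

theorem ContFamily.cubeComp {T : Type*} [TopologicalSpace T] {i : Fin (n + 1)}
    {A B : T → (singularCubes F).cell (n + 1)} (hA : ContFamily A) (hB : ContFamily B)
    (h : ∀ t, (singularCubes F).face true i (A t) = (singularCubes F).face false i (B t)) :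
    ContFamily fun t => cubeComp i (A t) (B t) (h t) := by
  have h1 := continuous_firstHalf
  have h2 := continuous_secondHalf
  have hu : ∀ f : I → I, Continuous f → Continuous fun p : T × (Fin (n + 1) → I) =>
      (p.1, Function.update p.2 i (f (p.2 i))) := fun f hf =>
    continuous_fst.prodMk (continuous_snd.update i (hf.comp (by fun_prop)))
  refine Continuous.if_le (hA.comp (hu _ h1)) (hB.comp (hu _ h2)) (by fun_prop) (by fun_prop)
    fun p hp => ?_
  rw [firstHalf_eq_one hp.ge, secondHalf_eq_zero hp.le]
  exact face_eq_iff.1 (h p.1) p.2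

/-- The joint face may move, provided the two cubes match at every time. A point of `S` lies on an
outer face of the composite, where only one of the factors is seen, at an unchanged point. -/
theorem HomRel.cubeComp_path {i : Fin (n + 1)} {A B : I → (singularCubes F).cell (n + 1)}
    (hA : ContFamily A) (hB : ContFamily B)
    (h : ∀ t, (singularCubes F).face true i (A t) = (singularCubes F).face false i (B t))
    {S : Set (Fin (n + 1) → I)} (hS : S ⊆ ends i)
    (hAS : ∀ t, ∀ v ∈ S, v i = 0 → (A t).1 v = (A 0).1 v)
    (hBS : ∀ t, ∀ v ∈ S, v i = 1 → (B t).1 v = (B 0).1 v) :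
    HomRel S (cubeComp i (A 0) (B 0) (h 0)) (cubeComp i (A 1) (B 1) (h 1)) := by
  refine .of_path (A := fun t => cubeComp i (A t) (B t) (h t)) (hA.cubeComp hB h) ?_
  intro t v hv
  rcases hS hv with h0 | h0
  · simp only [cubeComp_apply_zero h0, hAS t v hv h0]
  · simp only [cubeComp_apply_one h0, hBS t v hv h0]

/-- Homotopies that both fix the joint face stay composable at every time. -/
theorem HomRel.cubeComp {i : Fin (n + 1)} {a a' b b' : (singularCubes F).cell (n + 1)}
    {S S' T : Set (Fin (n + 1) → I)} (ha : HomRel S a a') (hb : HomRel S' b b') (h)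
    (hS : {t | t i = endpoint true} ⊆ S) (hS' : {t | t i = endpoint false} ⊆ S')
    (hT : T ⊆ ends i) (hTS : T ⊆ S) (hTS' : T ⊆ S') :
    ∃ h', HomRel T (_root_.cubeComp i a b h) (_root_.cubeComp i a' b' h') := by
  obtain ⟨A, hA, rfl, rfl, hAS⟩ := ha.path
  obtain ⟨B, hB, rfl, rfl, hBS⟩ := hb.path
  have key : ∀ t, (singularCubes F).face true i (A t) = (singularCubes F).face false i (B t) := by
    intro t
    rw [face_eq_of (a := A t) (b := A 0) fun v hv => hAS t v (hS hv), h]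
    exact (face_eq_of (a := B t) (b := B 0) fun v hv => hBS t v (hS' hv)).symm
  exact ⟨key 1, cubeComp_path hA hB key hT (fun t v hv _ => hAS t v (hTS hv))
    fun t v hv _ => hBS t v (hTS' hv)⟩

theorem HomRel.cubeComp_ends {i : Fin (n + 1)} {a a' b b' : (singularCubes F).cell (n + 1)}
    (ha : HomRel (ends i) a a') (hb : HomRel (ends i) b b') (h) :
    ∃ h', HomRel (ends i) (_root_.cubeComp i a b h) (_root_.cubeComp i a' b' h') :=
  ha.cubeComp hb h (fun _ h => Or.inr h) (fun _ h => Or.inl h) le_rfl le_rfl le_rfl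

/-! ### Reparametrisation -/

/-- The point dividing the segment from `x` to `y` in the ratio `s : 1 - s`. -/
noncomputable def segment (s x y : I) : I :=
  Set.projIcc 0 1 zero_le_one ((1 - (s : ℝ)) * x + s * y)

theorem segment_zero (x y : I) : segment 0 x y = x := by simp [segment]

theorem segment_one (x y : I) : segment 1 x y = y := by simp [segment]

theorem segment_self (s x : I) : segment s x x = x := by
  have : (1 - (s : ℝ)) * x + s * x = x := by ring
  simp [segment, this]

theorem continuous_segment : Continuous fun p : I × I × I => segment p.1 p.2.1 p.2.2 := by
  unfold segment; fun_prop

theorem homRel_of_update {i : Fin n} {a b b' : (singularCubes F).cell n}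
    {ψ ψ' : (Fin n → I) → I} (hψ : Continuous ψ) (hψ' : Continuous ψ')
    (hb : ∀ t, b.1 t = a.1 (Function.update t i (ψ t)))
    (hb' : ∀ t, b'.1 t = a.1 (Function.update t i (ψ' t)))
    (h : ∀ t, t i = 0 ∨ t i = 1 → (ψ t = 0 ∨ ψ t = 1) ∧ ψ' t = ψ t) :
    HomRel (ends i) b b' := by
  have hc : Continuous fun p : I × (Fin n → I) =>
      Function.update p.2 i (segment p.1 (ψ p.2) (ψ' p.2)) :=
    continuous_snd.update i (continuous_segment.comp (f := fun p : I × (Fin n → I) =>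
      (p.1, ψ p.2, ψ' p.2)) (by fun_prop))
  let A : I → (singularCubes F).cell n := fun s =>
    ⟨⟨fun t => a.1 (Function.update t i (segment s (ψ t) (ψ' t))), a.1.continuous.comp
      (hc.comp (f := fun t => (s, t)) (by fun_prop))⟩, by
      intro k t ht
      refine a.2 k _ (update_mem_cubeFilt i (fun h0 => ?_) ht)
      rw [(h t h0).2, segment_self]
      exact (h t h0).1⟩
  have e0 : A 0 = b := cell_ext fun t => by
    change a.1 (Function.update t i (segment 0 _ _)) = _
    rw [segment_zero, hb]
  have e1 : A 1 = b' := cell_ext fun t => by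
    change a.1 (Function.update t i (segment 1 _ _)) = _
    rw [segment_one, hb']
  rw [← e0, ← e1]
  refine .of_path (a.1.continuous.comp hc) fun s v hv => ?_
  change a.1 (Function.update v i (segment s _ _)) = a.1 (Function.update v i (segment 0 _ _))
  rw [(h v hv).2, segment_self, segment_self]

/-! ### Unit, inverse and associativity laws as reparametrisations. -/

theorem degen_face_apply (α : Bool) (i : Fin (n + 1)) (a : (singularCubes F).cell (n + 1))
    (t : Fin (n + 1) → I) : ((singularCubes F).degen i ((singularCubes F).face α i a)).1 t =
      a.1 (Function.update t i (endpoint α)) := face_codegen α i a t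

theorem degen_cubeComp (i : Fin (n + 1)) (a : (singularCubes F).cell (n + 1)) (h) :
    HomRel (ends i) (cubeComp i ((singularCubes F).degen i ((singularCubes F).face false i a)) a h)
      a := by
  have := continuous_secondHalf
  refine homRel_of_update (i := i) (a := a) (ψ := fun t => secondHalf (t i)) (ψ' := fun t => t i)
    (by fun_prop) (by fun_prop) (fun t => ?_) (fun t => ?_) ?_
  · rw [cubeComp_apply]
    split_ifs with ht
    · rw [degen_face_apply, Function.update_idem, secondHalf_eq_zero ht]; rfl
    · rfl
  · rw [Function.update_eq_self]
  · rintro t (ht | ht)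
    · simp [ht, secondHalf_eq_zero]
    · simp [ht, secondHalf_one]

theorem cubeComp_degen (i : Fin (n + 1)) (a : (singularCubes F).cell (n + 1)) (h) :
    HomRel (ends i) (cubeComp i a ((singularCubes F).degen i ((singularCubes F).face true i a)) h)
      a := by
  have := continuous_firstHalf
  refine homRel_of_update (i := i) (a := a) (ψ := fun t => firstHalf (t i)) (ψ' := fun t => t i)
    (by fun_prop) (by fun_prop) (fun t => ?_) (fun t => ?_) ?_
  · rw [cubeComp_apply]
    split_ifs with ht
    · rfl
    · rw [degen_face_apply, Function.update_idem, firstHalf_eq_one (not_le.1 ht).le]; rfl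
  · rw [Function.update_eq_self]
  · rintro t (ht | ht)
    · simp [ht, firstHalf_zero]
    · have : firstHalf 1 = 1 := firstHalf_eq_one (by norm_num)
      simp [ht, this]

/-- The reverse of a cube in the direction `i`. -/
noncomputable def reverse (i : Fin n) (a : (singularCubes F).cell n) : (singularCubes F).cell n :=
  ⟨⟨fun t => a.1 (Function.update t i (σ (t i))), a.1.continuous.comp
    (continuous_id.update i (by fun_prop))⟩, fun k t ht =>
      a.2 k _ (update_mem_cubeFilt i (by rintro (h | h) <;> simp [h]) ht)⟩

theorem reverse_apply (i : Fin n) (a : (singularCubes F).cell n) (t : Fin n → I) :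
    (reverse i a).1 t = a.1 (Function.update t i (σ (t i))) := rfl

theorem face_reverse (α : Bool) (i : Fin (n + 1)) (a : (singularCubes F).cell (n + 1)) :
    (singularCubes F).face α i (reverse i a) = (singularCubes F).face (!α) i a := by
  refine face_eq_iff.2 fun t => ?_
  rw [reverse_apply]
  cases α <;> simp [endpoint]

theorem reverse_reverse (i : Fin n) (a : (singularCubes F).cell n) :
    reverse i (reverse i a) = a :=
  cell_ext fun t => by simp [reverse_apply]

theorem cubeComp_reverse (i : Fin (n + 1)) (a : (singularCubes F).cell (n + 1)) (h) :
    HomRel (ends i) (cubeComp i a (reverse i a) h)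
      ((singularCubes F).degen i ((singularCubes F).face false i a)) := by
  have := continuous_firstHalf
  have := continuous_secondHalf
  refine homRel_of_update (i := i) (a := a)
    -- This is the tent going from `0` up to `1` at the midpoint and back, contracted to the
    -- constant `0`.
    (ψ := fun t => min (firstHalf (t i)) (σ (secondHalf (t i)))) (ψ' := fun t => 0)
    (by fun_prop) (by fun_prop) (fun t => ?_) (fun t => ?_) ?_
  · rw [cubeComp_apply]
    split_ifs with ht
    · rw [secondHalf_eq_zero ht]
      simp [unitInterval.le_one']
    · rw [firstHalf_eq_one (not_le.1 ht).le, reverse_apply, Function.update_idem]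
      simp [unitInterval.le_one']
  · exact degen_face_apply ..
  · rintro t (ht | ht)
    · simp [ht, firstHalf_zero]
    · simp [ht, secondHalf_one]

theorem reverse_cubeComp (i : Fin (n + 1)) (a : (singularCubes F).cell (n + 1)) (h) :
    HomRel (ends i) (cubeComp i (reverse i a) a h)
      ((singularCubes F).degen i ((singularCubes F).face true i a)) := by
  have h' : (singularCubes F).face true i (reverse i a) =
      (singularCubes F).face false i (reverse i (reverse i a)) := by rwa [reverse_reverse]
  have := cubeComp_reverse i (reverse i a) h'
  simpa only [reverse_reverse, face_reverse, Bool.not_false] using this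

theorem cubeComp_assoc (i : Fin (n + 1)) (a b c : (singularCubes F).cell (n + 1))
    (hab) (hbc) (h₁) (h₂) : HomRel (ends i) (cubeComp i (cubeComp i a b hab) c h₁)
      (cubeComp i a (cubeComp i b c hbc) h₂) := by
  refine homRel_of_update (i := i) (a := cubeComp i a (cubeComp i b c hbc) h₂)
    -- The change of parameter carrying the breakpoints `1/4, 1/2` of the left bracketing to `1/2,
    -- 3/4`. It is concave, hence the minimum of its three affine pieces.
    (ψ := fun t => Set.projIcc 0 1 zero_le_one
      (min (min (2 * (t i : ℝ)) (t i + 1 / 4)) ((t i + 1) / 2))) (ψ' := fun t => t i)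
    (by fun_prop) (by fun_prop) (fun t => ?_) (fun t => ?_) ?_
  · have h0 := (t i).2.1
    have h1 := (t i).2.2
    set p : I := Set.projIcc 0 1 zero_le_one
      (min (min (2 * (t i : ℝ)) (t i + 1 / 4)) ((t i + 1) / 2)) with hp
    have hp' : (p : ℝ) = min (min (2 * (t i : ℝ)) (t i + 1 / 4)) ((t i + 1) / 2) := by
      rw [hp, coe_projIcc, max_eq_right, min_eq_right]
      · exact (min_le_right _ _).trans (by linarith)
      · refine le_min zero_le_one (le_min (le_min ?_ ?_) ?_) <;> linarith
    simp only [cubeComp_apply, Function.update_self, Function.update_idem]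
    rcases le_or_gt (t i : ℝ) (1 / 4) with h4 | h4
    · have e : (p : ℝ) = 2 * t i := by
        rw [hp', min_eq_left, min_eq_left] <;> grind
      rw [if_pos (by linarith), if_pos (by rw [coe_firstHalf]; grind), if_pos (by linarith)]
      congr 2
      ext; simp only [coe_firstHalf]; grind
    · rcases le_or_gt (t i : ℝ) (1 / 2) with h2 | h2
      · have e : (p : ℝ) = t i + 1 / 4 := by
          rw [hp', min_eq_left, min_eq_right] <;> grind
        rw [if_pos h2, if_neg (by rw [coe_firstHalf]; grind), if_neg (by linarith),
          if_pos (by rw [coe_secondHalf]; grind)]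
        congr 2
        ext; simp only [coe_firstHalf, coe_secondHalf]; grind
      · have e : (p : ℝ) = (t i + 1) / 2 := by
          rw [hp', min_eq_right]; grind
        rw [if_neg h2.not_ge, if_neg (by linarith), if_neg (by rw [coe_secondHalf]; grind)]
        congr 2
        ext; simp only [coe_secondHalf]; grind
  · rw [Function.update_eq_self]
  · rintro t (ht | ht)
    · have : (min (min (2 * (0 : ℝ)) (0 + 1 / 4)) ((0 + 1) / 2)) = 0 := by norm_num
      simp [ht]
    · have : 1 ≤ (min (min (2 * (1 : ℝ)) (1 + 1 / 4)) ((1 + 1) / 2)) := by norm_num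
      simp only [ht, Set.Icc.coe_one]
      rw [Set.projIcc_of_right_le _ this]
      exact ⟨Or.inr rfl, rfl⟩

/-! ### Contracting a cube to a vertex, one coordinate at a time -/

/-- The `j`-th coordinate of the edge path from the vertex `(1, …, 1)` to the vertex `(0, …, 0)`
of the `n`-cube that moves one coordinate after the other. -/
noncomputable def edgePath (j : Fin n) (s : I) : I :=
  Set.projIcc 0 1 zero_le_one (1 - (n * (s : ℝ) - j))

theorem edgePath_zero (j : Fin n) : edgePath j 0 = 1 :=
  Set.projIcc_of_right_le _ (by simp)

theorem edgePath_one (j : Fin n) : edgePath j 1 = 0 := by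
  refine Set.projIcc_of_le_left _ ?_
  have : ((j : ℕ) : ℝ) + 1 ≤ n := by exact_mod_cast j.2
  simp only [Set.Icc.coe_one]
  linarith

theorem continuous_edgePath (j : Fin n) : Continuous (edgePath j) := by
  unfold edgePath; fun_prop

/-- The `j`-th coordinate moves only while `n * s` lies in the open interval `(j, j + 1)`, and these
intervals are disjoint. -/
theorem eq_of_edgePath_interior {s : I} {j k : Fin n} (hj : edgePath j s ≠ 0 ∧ edgePath j s ≠ 1)
    (hk : edgePath k s ≠ 0 ∧ edgePath k s ≠ 1) : j = k := by
  have key : ∀ j : Fin n, edgePath j s ≠ 0 ∧ edgePath j s ≠ 1 →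
      ((j : ℕ) : ℝ) < n * s ∧ (n * s : ℝ) < (j : ℕ) + 1 := by
    rintro j ⟨h0, h1⟩
    constructor
    · by_contra! h
      exact h1 (Set.projIcc_of_right_le _ (by linarith))
    · by_contra! h
      exact h0 (Set.projIcc_of_le_left _ (by linarith))
  obtain ⟨h1, h2⟩ := key j hj
  obtain ⟨h3, h4⟩ := key k hk
  have h5 : (j : ℕ) < k + 1 := by exact_mod_cast h1.trans h4
  have h6 : (k : ℕ) < j + 1 := by exact_mod_cast h3.trans h2
  exact Fin.ext (by omega)

open Classical in
/-- A filtered contraction of the `n`-cube to its vertex `(1, …, 1)`, the coordinate `tᵢ` being the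
time. -/
noncomputable def cone (i : Fin (n + 1)) : FilteredMap (cubeFilt (n + 1)) (cubeFilt n) :=
  ⟨⟨fun t j => max (t (i.succAbove j)) (edgePath j (t i)), continuous_pi fun j =>
    (continuous_apply _).max ((continuous_edgePath j).comp (continuous_apply i))⟩, by
    intro k t ht
    -- An interior coordinate of the image is charged to the same coordinate of `t` if that is
    -- interior, and otherwise to the time `tᵢ`. The latter happens for at most one `j`, because the
    -- edge path moves one coordinate at a time, and only for interior `tᵢ`.
    let c : Fin n → Fin (n + 1) := fun j =>
      if t (i.succAbove j) ≠ 0 ∧ t (i.succAbove j) ≠ 1 then i.succAbove j else i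
    have hmax : ∀ j, max (t (i.succAbove j)) (edgePath j (t i)) ≠ 0 ∧
        max (t (i.succAbove j)) (edgePath j (t i)) ≠ 1 →
        ¬ (t (i.succAbove j) ≠ 0 ∧ t (i.succAbove j) ≠ 1) →
        edgePath j (t i) ≠ 0 ∧ edgePath j (t i) ≠ 1 := by
      rintro j hj hj'
      rcases max_choice (t (i.succAbove j)) (edgePath j (t i)) with h | h
      · rw [h] at hj; exact absurd hj hj'
      · rwa [h] at hj
    refine cubeFilt_of_injOn (t := t) c ?_ ?_ ht
    · intro j hj
      simp only [c]
      split_ifs with h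
      · exact h
      · have := hmax j hj h
        constructor
        · intro h0; rw [h0, edgePath_zero] at this; exact this.2 rfl
        · intro h0; rw [h0, edgePath_one] at this; exact this.1 rfl
    · intro a ha b hb hab
      simp only [c] at hab
      split_ifs at hab with h h' h'
      · exact Fin.succAbove_right_injective hab
      · exact absurd hab (Fin.succAbove_ne i a)
      · exact absurd hab.symm (Fin.succAbove_ne i b)
      · exact eq_of_edgePath_interior (hmax a ha h) (hmax b hb h')⟩

theorem cone_zero {i : Fin (n + 1)} {t : Fin (n + 1) → I} (ht : t i = 0) :
    cone i t = fun _ => 1 :=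
  funext fun j => by
    change max (t (i.succAbove j)) (edgePath j (t i)) = 1
    rw [ht, edgePath_zero, max_eq_right unitInterval.le_one']

theorem cone_one {i : Fin (n + 1)} {t : Fin (n + 1) → I} (ht : t i = 1) :
    cone i t = codegen i t :=
  funext fun j => by
    change max (t (i.succAbove j)) (edgePath j (t i)) = t (i.succAbove j)
    rw [ht, edgePath_one, max_eq_left unitInterval.nonneg']

theorem one_mem_filt_zero : (fun _ => 1 : Fin n → I) ∈ (cubeFilt n).filt 0 :=
  mem_cubeFilt_zero.2 fun _ => Or.inr rfl

/-- The contraction of the cube `c` to a vertex, as a cube. -/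
noncomputable def coneCube (i : Fin (n + 1)) (c : (singularCubes F).cell n) :
    (singularCubes F).cell (n + 1) := FilteredMap.comp c (cone i)

theorem coneCube_apply (i : Fin (n + 1)) (c : (singularCubes F).cell n) (t : Fin (n + 1) → I) :
    (coneCube i c).1 t = c.1 (cone i t) := rfl

theorem face_true_coneCube (i : Fin (n + 1)) (c : (singularCubes F).cell n) :
    (singularCubes F).face true i (coneCube i c) = c := by
  refine cell_ext fun t => ?_
  rw [face_apply, coneCube_apply, cone_one (coface_self true i t), codegen_coface]

theorem coneCube_apply_zero (i : Fin (n + 1)) (c : (singularCubes F).cell n)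
    {t : Fin (n + 1) → I} (ht : t i = 0) : (coneCube i c).1 t = c.1 fun _ => 1 := by
  rw [coneCube_apply, cone_zero ht]

/-- The initial face of a cone remembers only the value at the vertex `(1, …, 1)`, so it does not
move under a homotopy rel vertices. -/
theorem face_false_coneCube {i : Fin (n + 1)} {c c' : (singularCubes F).cell n}
    (h : c.1 (fun _ => 1) = c'.1 fun _ => 1) :
    (singularCubes F).face false i (coneCube i c) =
      (singularCubes F).face false i (coneCube i c') :=
  face_eq_of fun t ht => by rw [coneCube_apply_zero i c ht, coneCube_apply_zero i c' ht, h]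

/-! ### Homotopies between cubes with a common face -/

theorem ContFamily.face {T : Type*} [TopologicalSpace T] {A : T → (singularCubes F).cell (n + 1)}
    (hA : ContFamily A) (α : Bool) (i : Fin (n + 1)) :
    ContFamily fun t => (singularCubes F).face α i (A t) :=
  hA.comp (f := fun p : T × (Fin n → I) => (p.1, coface α i p.2))
    (continuous_fst.prodMk ((coface α i).1.continuous.comp continuous_snd))

theorem ContFamily.coneCube {T : Type*} [TopologicalSpace T] {A : T → (singularCubes F).cell n}
    (hA : ContFamily A) (i : Fin (n + 1)) : ContFamily fun t => coneCube i (A t) :=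
  hA.comp (f := fun p : T × (Fin (n + 1) → I) => (p.1, cone i p.2))
    (continuous_fst.prodMk ((cone i).1.continuous.comp continuous_snd))

theorem ContFamily.const {T : Type*} [TopologicalSpace T] (a : (singularCubes F).cell n) :
    ContFamily fun _ : T => a :=
  a.1.continuous.comp continuous_snd

theorem coface_mem_filt_zero (α : Bool) (i : Fin (n + 1)) {t : Fin n → I}
    (ht : t ∈ (cubeFilt n).filt 0) : coface α i t ∈ (cubeFilt (n + 1)).filt 0 :=
  (coface α i).2 0 t ht

theorem codegen_mem_filt_zero (i : Fin (n + 1)) {t : Fin (n + 1) → I}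
    (ht : t ∈ (cubeFilt (n + 1)).filt 0) : codegen i t ∈ (cubeFilt n).filt 0 :=
  (codegen i).2 0 t ht

/-- A cube is homotopic, relative to two opposite faces, to the composite that starts by
contracting its first face to a vertex and expanding it again. -/
theorem homRel_insert_cone (i : Fin (n + 1)) (a : (singularCubes F).cell (n + 1))
    {c c' : (singularCubes F).cell n} (hc : (singularCubes F).face false i a = c)
    (hc' : (singularCubes F).face false i a = c') (h₁ h₂) :
    HomRel (ends i) (cubeComp i (reverse i (coneCube i c)) (cubeComp i (coneCube i c') a h₁) h₂)
      a := by
  -- The two names for the face serve `HomRel.rel_face`, where one cone is built on the fixed face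
  -- and the other on the final value of a moving face.
  subst hc hc'
  set c := (singularCubes F).face false i a with hc
  set V := coneCube i c with hV
  have hrev : (singularCubes F).face true i (reverse i V) = (singularCubes F).face false i V :=
    face_reverse true i V
  have hcomp : (singularCubes F).face true i (cubeComp i (reverse i V) V hrev) =
      (singularCubes F).face false i a := by rw [face_true_cubeComp, h₁]
  refine (cubeComp_assoc i (reverse i V) V a hrev h₁ hcomp h₂).symm.trans ?_
  obtain ⟨h', H⟩ := (reverse_cubeComp i V hrev).cubeComp_ends (HomRel.refl (ends i) a) hcomp
  refine H.trans ?_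
  have hVc : (singularCubes F).face true i V = c := face_true_coneCube i c
  simp only [hVc, hc]
  exact degen_cubeComp i a _

/-- The face traces a loop `γ` of cubes which need not be contractible. Consider the composites of
the reversed cone of `c`, the cone of `γ t`, and `A t`: their first face is constantly `c`, and the
motion of `γ` is absorbed inside. -/
theorem HomRel.rel_face {i : Fin (n + 1)} {a a' : (singularCubes F).cell (n + 1)}
    (h : HomRel ((cubeFilt (n + 1)).filt 0) a a')
    (hf : (singularCubes F).face false i a = (singularCubes F).face false i a') :
    HomRel (faceVert false i) a a' := by
  obtain ⟨A, hA, rfl, rfl, hS⟩ := h.path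
  let c := (singularCubes F).face false i (A 0)
  let γ : I → (singularCubes F).cell n := fun t => (singularCubes F).face false i (A t)
  have hγ : ContFamily γ := hA.face false i
  have hv : ∀ t, (γ t).1 (fun _ => 1) = c.1 (fun _ => 1) := fun t =>
    hS t _ (coface_mem_filt_zero false i one_mem_filt_zero)
  have h₁ : ∀ t, (singularCubes F).face true i (coneCube i (γ t)) =
      (singularCubes F).face false i (A t) := fun t => face_true_coneCube i (γ t)
  have h₂ : ∀ t, (singularCubes F).face true i (reverse i (coneCube i c)) =
      (singularCubes F).face false i (_root_.cubeComp i (coneCube i (γ t)) (A t) (h₁ t)) := fun t => by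
    rw [face_reverse, face_false_cubeComp]
    exact face_false_coneCube (hv t).symm
  have key := HomRel.cubeComp_path (ContFamily.const (reverse i (coneCube i c)))
    ((hγ.coneCube i).cubeComp hA h₁) h₂ (S := faceVert false i) (faceVert_subset_ends false i)
    (fun _ _ _ _ => rfl) (by
      intro t v hv hv1
      rw [cubeComp_apply_one hv1, cubeComp_apply_one hv1]
      rcases hv with hv | hv
      · exact hS t v hv
      · rw [Set.mem_ofPred_eq, hv1] at hv; exact absurd hv (by simp [endpoint]))
  -- At both end times `γ t` equals `c`, so the two cones cancel relative to the end faces.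
  have e0 := homRel_insert_cone i (A 0) rfl rfl (h₁ 0) (h₂ 0)
  have e1 := homRel_insert_cone i (A 1) hf.symm rfl (h₁ 1) (h₂ 1)
  exact ((e0.mono (faceVert_subset_ends false i)).symm.trans key).trans
    (e1.mono (faceVert_subset_ends false i))

/-! ### Thin cubes -/

/-- A homotopy of `n`-cubes, as a cube whose coordinate `tᵢ` is the time. -/
def thin (i : Fin (n + 1)) (Θ : I → (singularCubes F).cell n) (hΘ : ContFamily Θ) :
    (singularCubes F).cell (n + 1) :=
  ⟨⟨fun t => (Θ (t i)).1 (codegen i t), hΘ.comp (f := fun t : Fin (n + 1) → I =>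
    (t i, codegen i t)) ((continuous_apply i).prodMk (codegen i).1.continuous)⟩, fun k t ht =>
      (Θ (t i)).2 k _ ((codegen i).2 k t ht)⟩

theorem thin_apply (i : Fin (n + 1)) (Θ : I → (singularCubes F).cell n) (hΘ : ContFamily Θ)
    (t : Fin (n + 1) → I) : (thin i Θ hΘ).1 t = (Θ (t i)).1 (codegen i t) := rfl

theorem face_thin (α : Bool) (i : Fin (n + 1)) (Θ : I → (singularCubes F).cell n)
    (hΘ : ContFamily Θ) : (singularCubes F).face α i (thin i Θ hΘ) = Θ (endpoint α) :=
  cell_ext fun t => by rw [face_apply, thin_apply, coface_self, codegen_coface]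

/-- Skip the time before `s`, running `Θ (max t s)`. This leaves the last face untouched and ends in
a degenerate cube. -/
theorem thin_homRel (i : Fin (n + 1)) (Θ : I → (singularCubes F).cell n) (hΘ : ContFamily Θ)
    (hS : ∀ t, ∀ v ∈ (cubeFilt n).filt 0, (Θ t).1 v = (Θ 1).1 v) :
    HomRel (faceVert true i) (thin i Θ hΘ) ((singularCubes F).degen i (Θ 1)) := by
  have hc : ∀ s : I, ContFamily fun t => Θ (max t s) := fun s =>
    hΘ.comp (f := fun p : I × (Fin n → I) => (max p.1 s, p.2)) (by fun_prop)
  have e0 : thin i (fun t => Θ (max t 0)) (hc 0) = thin i Θ hΘ := cell_ext fun t => by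
    rw [thin_apply, thin_apply, max_eq_left unitInterval.nonneg']
  have e1 : thin i (fun t => Θ (max t 1)) (hc 1) = (singularCubes F).degen i (Θ 1) :=
    cell_ext fun t => by
      rw [thin_apply, degen_apply, max_eq_right unitInterval.le_one']
  rw [← e0, ← e1]
  refine HomRel.of_path (A := fun s => thin i (fun t => Θ (max t s)) (hc s)) ?_ ?_
  · exact hΘ.comp (f := fun p : I × (Fin (n + 1) → I) => (max (p.2 i) p.1, codegen i p.2))
      (Continuous.prodMk (by fun_prop) ((codegen i).1.continuous.comp continuous_snd))
  · intro s v hv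
    rw [thin_apply, thin_apply]
    rcases hv with hv | hv
    · rw [hS _ _ (codegen_mem_filt_zero i hv), hS (max (v i) 0) _ (codegen_mem_filt_zero i hv)]
    · change v i = 1 at hv
      rw [hv, max_eq_left unitInterval.le_one', max_eq_left unitInterval.le_one']

/-- The thin factor deforms to a degenerate one relative to the joint face, after which the unit law
applies. -/
theorem thin_cubeComp (i : Fin (n + 1)) (Θ : I → (singularCubes F).cell n) (hΘ : ContFamily Θ)
    (hS : ∀ t, ∀ v ∈ (cubeFilt n).filt 0, (Θ t).1 v = (Θ 1).1 v)
    (b : (singularCubes F).cell (n + 1)) (h) :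
    HomRel ((cubeFilt (n + 1)).filt 0) (cubeComp i (thin i Θ hΘ) b h) b := by
  obtain ⟨h', H⟩ := (thin_homRel i Θ hΘ hS).cubeComp (HomRel.refl Set.univ b) h
    Set.subset_union_right (Set.subset_univ _) (filt_zero_subset_ends i)
    (filt_zero_subset_faceVert true i) (Set.subset_univ _)
  have hb : Θ 1 = (singularCubes F).face false i b := by
    rw [← h, face_thin]; rfl
  refine H.trans ?_
  simp only [hb]
  exact (degen_cubeComp i b _).of_ends

/-- Homotopy extension: a homotopy of the first face of a cube in the direction `i` extends to a
homotopy of the cube. -/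
theorem exists_homRel_face_eq {i : Fin (n + 1)} {b : (singularCubes F).cell (n + 1)}
    {c : (singularCubes F).cell n}
    (h : HomRel ((cubeFilt n).filt 0) c ((singularCubes F).face false i b)) :
    ∃ b', HomRel ((cubeFilt (n + 1)).filt 0) b' b ∧ (singularCubes F).face false i b' = c := by
  obtain ⟨Θ, hΘ, rfl, h1, hS⟩ := h.path
  have h' : (singularCubes F).face true i (thin i Θ hΘ) = (singularCubes F).face false i b := by
    rw [face_thin, ← h1]; rfl
  refine ⟨cubeComp i (thin i Θ hΘ) b h', thin_cubeComp i Θ hΘ (fun t v hv => ?_) b h', ?_⟩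
  · rw [hS t v hv, hS 1 v hv]
  · rw [face_false_cubeComp, face_thin]; rfl

/-- Composition of cubes respects filtered homotopy. -/
theorem cubeComp_homRel {i : Fin (n + 1)} {a a' b b' : (singularCubes F).cell (n + 1)} (h h')
    (ha : HomRel ((cubeFilt (n + 1)).filt 0) a a')
    (hb : HomRel ((cubeFilt (n + 1)).filt 0) b b') :
    HomRel ((cubeFilt (n + 1)).filt 0) (cubeComp i a b h) (cubeComp i a' b' h') := by
  obtain ⟨A, hA, rfl, rfl, hS⟩ := ha.path
  let γ : I → (singularCubes F).cell n := fun t => (singularCubes F).face true i (A t)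
  have hγ : ContFamily γ := hA.face true i
  have hγS : ∀ s t, ∀ v ∈ (cubeFilt n).filt 0, (γ s).1 v = (γ t).1 v := fun s t v hv =>
    (hS s _ (coface_mem_filt_zero true i hv)).trans
      (hS t _ (coface_mem_filt_zero true i hv)).symm
  -- For fixed `t`, the path `s ↦ γ (t * σ s)` goes back from `γ t` to `γ 0`; thus `θ t` joins the
  -- last face of `A t` to the first face of `b`.
  have hΘ : ∀ t : I, ContFamily fun s => γ (t * σ s) := fun t =>
    hγ.comp (f := fun p : I × (Fin n → I) => (t * σ p.1, p.2)) (by fun_prop)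
  let θ : I → (singularCubes F).cell (n + 1) := fun t => thin i _ (hΘ t)
  have hθ : ContFamily θ :=
    hγ.comp (f := fun p : I × (Fin (n + 1) → I) => (p.1 * σ (p.2 i), codegen i p.2))
      (Continuous.prodMk (by fun_prop) ((codegen i).1.continuous.comp continuous_snd))
  have hθb : ∀ t, (singularCubes F).face true i (θ t) = (singularCubes F).face false i b := by
    intro t
    rw [← h, face_thin]
    simp [endpoint, γ]
  have hAθ : ∀ t, (singularCubes F).face true i (A t) =
      (singularCubes F).face false i (cubeComp i (θ t) b (hθb t)) := by
    intro t
    rw [face_false_cubeComp, face_thin]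
    simp [endpoint, γ]
  have hB : ∀ t, HomRel ((cubeFilt (n + 1)).filt 0) (cubeComp i (θ t) b (hθb t)) b := fun t =>
    thin_cubeComp i _ (hΘ t) (fun s v hv => hγS _ _ v hv) b (hθb t)
  have key := HomRel.cubeComp_path hA (hθ.cubeComp (ContFamily.const b) hθb) hAθ
    (filt_zero_subset_ends i) (fun t v hv _ => hS t v hv) (fun t v hv hv1 => by
      rw [cubeComp_apply_one hv1, cubeComp_apply_one hv1])
  -- Both homotopies of the second factor are made to fix the joint face, so that the first factor
  -- can be kept constant beside them.
  have h0 := ((hB 0).rel_face (i := i) ((hAθ 0).symm.trans h)).symm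
  have h1 := ((hB 1).trans hb).rel_face (i := i) ((hAθ 1).symm.trans h')
  have paste : ∀ (a b b' : (singularCubes F).cell (n + 1)) (h),
      HomRel (faceVert false i) b b' → ∃ h', HomRel ((cubeFilt (n + 1)).filt 0)
        (cubeComp i a b h) (cubeComp i a b' h') := fun a b b' h H =>
    (HomRel.refl Set.univ a).cubeComp H h (Set.subset_univ _) Set.subset_union_right
      (filt_zero_subset_ends i) (Set.subset_univ _) (filt_zero_subset_faceVert false i)
  obtain ⟨_, H0⟩ := paste (A 0) _ _ h h0
  obtain ⟨_, H1⟩ := paste (A 1) _ _ (hAθ 1) h1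
  exact H0.trans (key.trans H1)

/-! ### Laws that hold for singular cubes -/

/-- If `f` passes the `j`-th coordinate on unchanged as the `j'`-th and it affects no other, then
halving it commutes with `f`. Cofaces, projections and connections in other directions are of this
kind. -/
theorem cubeComp_precomp {m : ℕ} (f : FilteredMap (cubeFilt (m + 1)) (cubeFilt (n + 1)))
    {j : Fin (m + 1)} {j' : Fin (n + 1)}
    (hf : ∀ t s, f (Function.update t j s) = Function.update (f t) j' s)
    (a b : (singularCubes F).cell (n + 1)) (h) :
    ∃ h', FilteredMap.comp (cubeComp j' a b h) f =
      cubeComp (F := F) j (FilteredMap.comp a f) (FilteredMap.comp b f) h' := by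
  have hj : ∀ t, f t j' = t j := fun t => by
    have := congrFun (hf t (t j)) j'
    rwa [Function.update_eq_self, Function.update_self] at this
  have h' : (singularCubes F).face true j (FilteredMap.comp a f) =
      (singularCubes F).face false j (FilteredMap.comp b f) := face_eq_iff.2 fun t => by
    change a.1 (f (Function.update t j _)) = b.1 (f (Function.update t j _))
    rw [hf, hf]
    exact face_eq_iff.1 h (f t)
  refine ⟨h', cell_ext fun t => ?_⟩
  change (cubeComp j' a b h).1 (f t) = _
  change _ = if (t j : ℝ) ≤ 1 / 2 then a.1 (f (Function.update t j (firstHalf (t j))))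
    else b.1 (f (Function.update t j (secondHalf (t j))))
  rw [hf, hf, cubeComp_apply, hj]

theorem coface_update (α : Bool) (i : Fin (n + 2)) (j : Fin (n + 1)) (t : Fin (n + 1) → I)
    (s : I) : coface α i (Function.update t j s) =
      Function.update (coface α i t) (i.succAbove j) s := by
  funext l
  change (i.insertNth (endpoint α) (Function.update t j s) : Fin (n + 2) → I) l =
    Function.update (i.insertNth (endpoint α) t : Fin (n + 2) → I) _ s l
  rcases Fin.eq_self_or_eq_succAbove i l with rfl | ⟨m, rfl⟩
  · rw [Function.update_of_ne (Fin.succAbove_ne l j).symm]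
    simp
  · by_cases hm : m = j
    · subst hm; simp
    · rw [Function.update_of_ne (Fin.succAbove_right_injective.ne hm)]
      simp [hm]

theorem codegen_update_succAbove (i : Fin (n + 2)) (j : Fin (n + 1)) (t : Fin (n + 2) → I)
    (s : I) : codegen i (Function.update t (i.succAbove j) s) =
      Function.update (codegen i t) j s := by
  funext l
  change Function.update t (i.succAbove j) s (i.succAbove l) =
    Function.update (fun l => t (i.succAbove l)) j s l
  by_cases hl : l = j
  · subst hl; simp
  · rw [Function.update_of_ne (Fin.succAbove_right_injective.ne hl), Function.update_of_ne hl]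

theorem coconn_update_lt (α : Bool) {i j : Fin (n + 1)} (h : i < j) (t : Fin (n + 2) → I)
    (s : I) : coconn α i (Function.update t j.succ s) = Function.update (coconn α i t) j s := by
  funext l
  simp only [coconn_apply, Function.update_apply, Fin.ext_iff, Fin.lt_def, Fin.val_succ] at *
  grind

theorem coconn_update_gt (α : Bool) {i j : Fin (n + 1)} (h : j < i) (t : Fin (n + 2) → I)
    (s : I) : coconn α i (Function.update t j.castSucc s) =
      Function.update (coconn α i t) j s := by
  funext l
  simp only [coconn_apply, Function.update_apply, Fin.ext_iff, Fin.lt_def, Fin.val_castSucc] at *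
  grind

theorem coconn_update_update (α : Bool) (j : Fin (n + 1)) (t : Fin (n + 2) → I) (p q : I) :
    coconn α j (Function.update (Function.update t j.castSucc p) j.succ q) =
      Function.update (coconn α j t) j (signMax α p q) := by
  funext l
  simp only [coconn_apply, Function.update_apply, Fin.ext_iff, Fin.val_castSucc, Fin.val_succ]
  grind

theorem update_coconn_congr (α β : Bool) (j : Fin n) (t : Fin (n + 1) → I) (p : I) :
    Function.update (coconn α j t) j p = Function.update (coconn β j t) j p := by
  funext l
  simp only [coconn_apply, Function.update_apply, Fin.ext_iff]
  grind

/-- The `j`-th coordinate is overwritten, so the sign `α` is irrelevant. This form makes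
degeneracies comparable with connections. -/
theorem codegen_castSucc_update_update (α : Bool) (j : Fin (n + 1)) (t : Fin (n + 2) → I)
    (p q : I) : codegen j.castSucc (Function.update (Function.update t j.castSucc p) j.succ q) =
      Function.update (coconn α j t) j q := by
  funext l
  simp only [codegen_apply, coconn_apply, Function.update_apply, Fin.ext_iff, Fin.val_castSucc,
    Fin.val_succ]
  grind

theorem codegen_succ_update_update (α : Bool) (j : Fin (n + 1)) (t : Fin (n + 2) → I)
    (p q : I) : codegen j.succ (Function.update (Function.update t j.castSucc p) j.succ q) =
      Function.update (coconn α j t) j p := by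
  funext l
  simp only [codegen_apply, coconn_apply, Function.update_apply, Fin.ext_iff, Fin.val_castSucc,
    Fin.val_succ]
  grind

theorem cubeComp_interchange {i j : Fin (n + 1)} (hij : i ≠ j)
    (a b c d : (singularCubes F).cell (n + 1)) (hab hcd hac hbd) :
    ∃ h₁ h₂, cubeComp j (cubeComp i a b hab) (cubeComp i c d hcd) h₁ =
      cubeComp i (cubeComp j a c hac) (cubeComp j b d hbd) h₂ := by
  have hc : ∀ (t : Fin (n + 1) → I) (p q : I), Function.update (Function.update t j p) i q =
      Function.update (Function.update t i q) j p := fun t p q =>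
    Function.update_comm hij.symm _ _ _
  refine ⟨face_eq_iff.2 fun t => ?_, face_eq_iff.2 fun t => ?_, cell_ext fun t => ?_⟩
  · simp only [cubeComp_apply, Function.update_of_ne hij, hc]
    rw [face_eq_iff.1 hac, face_eq_iff.1 hbd]
  · simp only [cubeComp_apply, Function.update_of_ne hij.symm, ← hc]
    rw [face_eq_iff.1 hab, face_eq_iff.1 hcd]
  · simp only [cubeComp_apply, Function.update_of_ne hij, Function.update_of_ne hij.symm, hc]
    split_ifs <;> rfl

/-! ### Transport laws and cancellation of the connections. -/

theorem monotone_firstHalf : Monotone firstHalf := fun s t h =>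
  Set.monotone_projIcc _ (by have : (s : ℝ) ≤ t := h; linarith)

theorem monotone_secondHalf : Monotone secondHalf := fun s t h =>
  Set.monotone_projIcc _ (by have : (s : ℝ) ≤ t := h; linarith)

/-- Being monotone, the halving maps commute with `max`. On a mixed quadrant the coordinate at most
`1/2` contributes `0` to `secondHalf`, so only the other one survives and the quadrant is
degenerate. The dual law uses `min` and the value `1` of `firstHalf`. -/
theorem conn_false_cubeComp (j : Fin (n + 1)) (a b : (singularCubes F).cell (n + 1)) (h) :
    ∃ h₁ h₂ h₃, (singularCubes F).conn false j (cubeComp j a b h) =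
      cubeComp j.castSucc
        (cubeComp j.succ ((singularCubes F).conn false j a)
          ((singularCubes F).degen j.castSucc b) h₁)
        (cubeComp j.succ ((singularCubes F).degen j.succ b)
          ((singularCubes F).conn false j b) h₂) h₃ := by
  have hne : j.succ ≠ j.castSucc := (Fin.castSucc_lt_succ (i := j)).ne'
  have hb := face_eq_iff.1 h
  simp only [endpoint] at hb
  have h₁ : (singularCubes F).face true j.succ ((singularCubes F).conn false j a) =
      (singularCubes F).face false j.succ ((singularCubes F).degen j.castSucc b) := by
    rw [(singularCubes F).face_degen_gt _ _ _ le_rfl, ← h]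
    exact (singularCubes F).face_conn_not_succ true j a
  have h₂ : (singularCubes F).face true j.succ ((singularCubes F).degen j.succ b) =
      (singularCubes F).face false j.succ ((singularCubes F).conn false j b) := by
    rw [(singularCubes F).face_degen_self, (singularCubes F).face_conn_succ]
  refine ⟨h₁, h₂, face_eq_iff.2 fun t => ?_, cell_ext fun t => ?_⟩
  · simp only [cubeComp_apply, conn_apply, degen_apply, Function.update_of_ne hne,
      coconn_update_update, codegen_castSucc_update_update false,
      codegen_succ_update_update false, endpoint, signMax, max_eq_left unitInterval.le_one',
      max_eq_right unitInterval.nonneg', hb]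
  · have hm := max_le_iff (a := ((t j.castSucc : I) : ℝ)) (b := (t j.succ : I)) (c := 1 / 2)
    have hj : coconn false j t j = max (t j.castSucc) (t j.succ) := by
      rw [coconn_apply]; simp [signMax]; rfl
    have hcoe : ((max (t j.castSucc) (t j.succ) : I) : ℝ) =
      max ((t j.castSucc : I) : ℝ) (t j.succ : I) := Subtype.mono_coe _ |>.map_max
    rw [conn_apply, cubeComp_apply, hj, hcoe, monotone_firstHalf.map_max,
      monotone_secondHalf.map_max]
    simp only [cubeComp_apply, conn_apply, degen_apply, Function.update_of_ne hne,
      coconn_update_update, codegen_castSucc_update_update false,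
      codegen_succ_update_update false, signMax]
    by_cases h1 : ((t j.castSucc : I) : ℝ) ≤ 1 / 2 <;>
      by_cases h2 : ((t j.succ : I) : ℝ) ≤ 1 / 2
    · rw [if_pos (hm.2 ⟨h1, h2⟩), if_pos h1, if_pos h2]
    · rw [if_neg fun h => h2 (hm.1 h).2, if_pos h1, if_neg h2, secondHalf_eq_zero h1,
        max_eq_right unitInterval.nonneg']
    · rw [if_neg fun h => h1 (hm.1 h).1, if_neg h1, if_pos h2, secondHalf_eq_zero h2,
        max_eq_left unitInterval.nonneg']
    · rw [if_neg fun h => h1 (hm.1 h).1, if_neg h1, if_neg h2]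

theorem conn_true_cubeComp (j : Fin (n + 1)) (a b : (singularCubes F).cell (n + 1)) (h) :
    ∃ h₁ h₂ h₃, (singularCubes F).conn true j (cubeComp j a b h) =
      cubeComp j.castSucc
        (cubeComp j.succ ((singularCubes F).conn true j a)
          ((singularCubes F).degen j.succ a) h₁)
        (cubeComp j.succ ((singularCubes F).degen j.castSucc a)
          ((singularCubes F).conn true j b) h₂) h₃ := by
  have hne : j.succ ≠ j.castSucc := (Fin.castSucc_lt_succ (i := j)).ne'
  have hb := face_eq_iff.1 h
  simp only [endpoint] at hb
  have h₁ : (singularCubes F).face true j.succ ((singularCubes F).conn true j a) =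
      (singularCubes F).face false j.succ ((singularCubes F).degen j.succ a) := by
    rw [(singularCubes F).face_degen_self, (singularCubes F).face_conn_succ]
  have h₂ : (singularCubes F).face true j.succ ((singularCubes F).degen j.castSucc a) =
      (singularCubes F).face false j.succ ((singularCubes F).conn true j b) := by
    rw [(singularCubes F).face_degen_gt _ _ _ le_rfl, h]
    exact ((singularCubes F).face_conn_not_succ false j b).symm
  refine ⟨h₁, h₂, face_eq_iff.2 fun t => ?_, cell_ext fun t => ?_⟩
  · simp only [cubeComp_apply, conn_apply, degen_apply, Function.update_of_ne hne,
      coconn_update_update, codegen_castSucc_update_update true,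
      codegen_succ_update_update true, endpoint, signMax, min_eq_right unitInterval.le_one',
      min_eq_left unitInterval.nonneg', hb]
  · have hj : coconn true j t j = min (t j.castSucc) (t j.succ) := by
      rw [coconn_apply]; simp [signMax]; rfl
    have hcoe : ((min (t j.castSucc) (t j.succ) : I) : ℝ) =
      min ((t j.castSucc : I) : ℝ) (t j.succ : I) := Subtype.mono_coe _ |>.map_min
    rw [conn_apply, cubeComp_apply, hj, hcoe, monotone_firstHalf.map_min,
      monotone_secondHalf.map_min]
    simp only [cubeComp_apply, conn_apply, degen_apply, Function.update_of_ne hne,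
      coconn_update_update, codegen_castSucc_update_update true,
      codegen_succ_update_update true, signMax, min_le_iff]
    by_cases h1 : ((t j.castSucc : I) : ℝ) ≤ 1 / 2 <;>
      by_cases h2 : ((t j.succ : I) : ℝ) ≤ 1 / 2
    · rw [if_pos (Or.inl h1), if_pos h1, if_pos h2]
    · rw [if_pos (Or.inl h1), if_pos h1, if_neg h2, firstHalf_eq_one (not_le.1 h2).le,
        min_eq_left unitInterval.le_one']
    · rw [if_pos (Or.inr h2), if_neg h1, if_pos h2, firstHalf_eq_one (not_le.1 h1).le,
        min_eq_right unitInterval.le_one']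
    · rw [if_neg (not_or.2 ⟨h1, h2⟩), if_neg h1, if_neg h2]

/-- The two connections on a cube are mutually inverse up to homotopy. -/
theorem conn_cubeComp_conn_castSucc (i : Fin (n + 1)) (a : (singularCubes F).cell (n + 1)) :
    ∃ h, HomRel ((cubeFilt (n + 2)).filt 0) (cubeComp i.castSucc ((singularCubes F).conn true i a)
      ((singularCubes F).conn false i a) h) ((singularCubes F).degen i.succ a) := by
  have hne : i.castSucc ≠ i.succ := (Fin.castSucc_lt_succ (i := i)).ne
  have h1 := continuous_firstHalf
  have h2 := continuous_secondHalf
  have h : (singularCubes F).face true i.castSucc ((singularCubes F).conn true i a) =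
      (singularCubes F).face false i.castSucc ((singularCubes F).conn false i a) := by
    rw [(singularCubes F).face_conn_castSucc, (singularCubes F).face_conn_castSucc]
  refine ⟨h, HomRel.of_ends (i := i.castSucc) (homRel_of_update (i := i.castSucc)
    (a := (singularCubes F).degen i.succ a)
    -- As `p = t i.castSucc` runs from `0` to `1`, with `q = t i.succ`, the two halves read `min
    -- (2p) q` and `max (2p - 1) q`: a path rising from `0` to `q`, resting there, and rising to
    -- `1`.
    (ψ := fun t => max (min (firstHalf (t i.castSucc)) (t i.succ)) (secondHalf (t i.castSucc)))
    (ψ' := fun t => t i.castSucc) (by fun_prop) (by fun_prop) (fun t => ?_) (fun t => ?_) ?_)⟩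
  · have e : ∀ p, Function.update t i.castSucc p =
        Function.update (Function.update t i.castSucc p) i.succ (t i.succ) := fun p => by
      rw [Function.update_comm hne, Function.update_eq_self]
    rw [cubeComp_apply]
    simp only [conn_apply, degen_apply]
    rw [e (firstHalf _), e (secondHalf _), e (max _ _), coconn_update_update,
      coconn_update_update, codegen_succ_update_update true]
    split_ifs with ht
    · rw [secondHalf_eq_zero ht, max_eq_left unitInterval.nonneg']; rfl
    · rw [firstHalf_eq_one (not_le.1 ht).le, min_eq_right unitInterval.le_one',
        update_coconn_congr false true, max_comm]; rfl
  · rw [Function.update_eq_self]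
  · rintro t (ht | ht)
    · simp [ht, firstHalf_zero, secondHalf_eq_zero]
    · simp [ht, secondHalf_one, unitInterval.le_one']


theorem conn_cubeComp_conn_succ (i : Fin (n + 1)) (a : (singularCubes F).cell (n + 1)) :
    ∃ h, HomRel ((cubeFilt (n + 2)).filt 0) (cubeComp i.succ ((singularCubes F).conn true i a)
      ((singularCubes F).conn false i a) h) ((singularCubes F).degen i.castSucc a) := by
  have h1 := continuous_firstHalf
  have h2 := continuous_secondHalf
  have h : (singularCubes F).face true i.succ ((singularCubes F).conn true i a) =
      (singularCubes F).face false i.succ ((singularCubes F).conn false i a) := by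
    rw [(singularCubes F).face_conn_succ, (singularCubes F).face_conn_succ]
  refine ⟨h, HomRel.of_ends (i := i.succ) (homRel_of_update (i := i.succ)
    (a := (singularCubes F).degen i.castSucc a)
    (ψ := fun t => max (min (t i.castSucc) (firstHalf (t i.succ))) (secondHalf (t i.succ)))
    (ψ' := fun t => t i.succ) (by fun_prop) (by fun_prop) (fun t => ?_) (fun t => ?_) ?_)⟩
  · have e : ∀ p, Function.update t i.succ p =
        Function.update (Function.update t i.castSucc (t i.castSucc)) i.succ p := fun p => by
      rw [Function.update_eq_self]
    rw [cubeComp_apply]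
    simp only [conn_apply, degen_apply]
    rw [e (firstHalf _), e (secondHalf _), e (max _ _), coconn_update_update,
      coconn_update_update, codegen_castSucc_update_update true]
    split_ifs with ht
    · rw [secondHalf_eq_zero ht, max_eq_left unitInterval.nonneg']; rfl
    · rw [firstHalf_eq_one (not_le.1 ht).le, min_eq_left unitInterval.le_one',
        update_coconn_congr false true]; rfl
  · rw [Function.update_eq_self]
  · rintro t (ht | ht)
    · simp [ht, firstHalf_zero, secondHalf_eq_zero]
    · simp [ht, secondHalf_one, unitInterval.le_one']

/-! ### Representatives of composable classes -/

theorem toRho_eq_iff {a b : (singularCubes F).cell n} :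
    toRho F a = toRho F b ↔ HomRel ((cubeFilt n).filt 0) a b :=
  ⟨fun h => Quotient.exact h, fun h => Quotient.sound h⟩

theorem exists_toRho (x : (rho F).cell n) : ∃ a, toRho F a = x := Quotient.exists_rep x

/-- The left representative is prescribed, so longer chains can be matched one factor at a time. -/
theorem exists_rep_right {i : Fin (n + 1)} {a : (singularCubes F).cell (n + 1)}
    {y : (rho F).cell (n + 1)} (h : (rho F).face true i (toRho F a) = (rho F).face false i y) :
    ∃ b, toRho F b = y ∧ (singularCubes F).face true i a = (singularCubes F).face false i b := by
  obtain ⟨b, rfl⟩ := exists_toRho y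
  obtain ⟨b', hb', hf⟩ := exists_homRel_face_eq (i := i) (b := b) (toRho_eq_iff.1 h)
  exact ⟨b', toRho_eq_iff.2 hb', hf.symm⟩

theorem exists_reps {i : Fin (n + 1)} {x y : (rho F).cell (n + 1)}
    (h : (rho F).face true i x = (rho F).face false i y) :
    ∃ a b, toRho F a = x ∧ toRho F b = y ∧
      (singularCubes F).face true i a = (singularCubes F).face false i b := by
  obtain ⟨a, rfl⟩ := exists_toRho x
  obtain ⟨b, hb, hf⟩ := exists_rep_right h
  exact ⟨a, b, rfl, hb, hf⟩

/-- Three of the matchings are obtained one after another; the last, between `b` and `d` in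
direction `j`, then holds only up to homotopy. Correcting `d` must not spoil its matching with `c`,
so the homotopy is taken fixed on the face shared with `c`. -/
theorem exists_square_reps {i j : Fin (n + 1)} (hij : i ≠ j) {x y z w : (rho F).cell (n + 1)}
    (hxy : (rho F).face true i x = (rho F).face false i y)
    (hzw : (rho F).face true i z = (rho F).face false i w)
    (hxz : (rho F).face true j x = (rho F).face false j z)
    (hyw : (rho F).face true j y = (rho F).face false j w) :
    ∃ a b c d, toRho F a = x ∧ toRho F b = y ∧ toRho F c = z ∧ toRho F d = w ∧
      (singularCubes F).face true i a = (singularCubes F).face false i b ∧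
      (singularCubes F).face true i c = (singularCubes F).face false i d ∧
      (singularCubes F).face true j a = (singularCubes F).face false j c ∧
      (singularCubes F).face true j b = (singularCubes F).face false j d := by
  obtain ⟨a, b, rfl, rfl, hab⟩ := exists_reps hxy
  obtain ⟨c, rfl, hac⟩ := exists_rep_right hxz
  obtain ⟨d, rfl, hcd⟩ := exists_rep_right hzw
  -- `k` is the number that direction `i` receives inside a face in direction `j`.
  obtain ⟨k, hk⟩ := Fin.exists_succAbove_eq hij
  cases n with
  | zero => exact k.elim0
  | succ n =>
  have hki : ∀ (α : Bool) (t : Fin (n + 1) → I), coface α j t i = t k := fun α t => by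
    rw [← hk]; exact Fin.insertNth_apply_succAbove (α := fun _ => I) j (endpoint α) t k
  -- At the centre of the square the strict matchings through `a` and `c` already force `b` and `d`
  -- to agree.
  have habcd : ∀ t : Fin (n + 2) → I, t i = 0 →
      b.1 (Function.update t j 1) = d.1 (Function.update t j 0) := by
    intro t ht
    have e : ∀ s : I, Function.update t j s =
        Function.update (Function.update t j s) i 0 := fun s => by
      rw [Function.update_comm hij.symm, ← ht, Function.update_eq_self]
    rw [e 1, e 0]
    refine (face_eq_iff.1 hab _).symm.trans (.trans ?_ (face_eq_iff.1 hcd _))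
    rw [Function.update_comm hij.symm, Function.update_comm hij.symm]
    exact face_eq_iff.1 hac _
  have hcoface : ∀ (α : Bool) (t : Fin (n + 1) → I),
      coface α j t = Function.update (coface false j t) j (endpoint α) := fun α t => by
    rw [update_eq_coface]
    exact congrArg (coface α j) (codegen_coface false j t).symm
  have hbd : HomRel ((cubeFilt (n + 1)).filt 0) ((singularCubes F).face true j b)
    ((singularCubes F).face false j d) := toRho_eq_iff.1 hyw
  have hH := hbd.rel_face (i := k) (face_eq_of fun t ht => by
    rw [face_apply, face_apply, hcoface true, hcoface false, Function.update_idem]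
    exact habcd _ ((hki false t).trans ht))
  obtain ⟨Θ, hΘ, h0, h1, hS⟩ := hH.path
  have hθd : (singularCubes F).face true j (thin j Θ hΘ) = (singularCubes F).face false j d := by
    rw [face_thin, ← h1]; rfl
  have hεc : (singularCubes F).face true j
      ((singularCubes F).degen j ((singularCubes F).face false j c)) =
      (singularCubes F).face false j c := (singularCubes F).face_degen_self ..
  -- `d` is preceded by the thin correction, and `c` by a degenerate cube so that the two have equal
  -- length in direction `j`. They match along direction `i` because the correction is constant
  -- there.
  refine ⟨a, b, cubeComp j _ c hεc, cubeComp j (thin j Θ hΘ) d hθd, rfl, rfl,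
    toRho_eq_iff.2 (degen_cubeComp j c hεc).of_ends,
    toRho_eq_iff.2 (thin_cubeComp j Θ hΘ (fun t v hv => ?_) d hθd), hab,
    face_eq_iff.2 fun t => ?_, ?_, ?_⟩
  · rw [hS t v (Or.inl hv), hS 1 v (Or.inl hv)]
  · rw [cubeComp_apply, cubeComp_apply, Function.update_of_ne hij.symm,
      Function.update_of_ne hij.symm]
    split_ifs
    · rw [degen_face_apply, thin_apply, hS _ _ (Or.inr ?_), face_codegen, Function.update_idem,
        Function.update_comm hij, Function.update_comm hij]
      · have := face_eq_iff.1 hcd (Function.update t j 0)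
        refine this.trans ?_
        rw [Function.update_comm hij.symm]
        refine (habcd (Function.update t i 0) (Function.update_self ..)).symm.trans (congrArg b.1 ?_)
        funext l
        simp only [Function.update_apply, endpoint]
        split_ifs <;> rfl
      · change Function.update _ j _ (j.succAbove k) = 0
        rw [hk, Function.update_of_ne hij, Function.update_self]; rfl
    · rw [Function.update_comm hij, Function.update_comm hij]
      exact face_eq_iff.1 hcd _
  · rw [face_false_cubeComp, hac, (singularCubes F).face_degen_self]
  · rw [face_false_cubeComp, face_thin]; exact h0.symm

/-! ### The fundamental cubical `ω`-groupoid -/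

/-- The composition in `ϱ(X_*)`. -/
noncomputable def rhoComp (i : Fin (n + 1)) (x y : (rho F).cell (n + 1))
    (h : (rho F).face true i x = (rho F).face false i y) : (rho F).cell (n + 1) :=
  toRho F (cubeComp i _ _ (exists_reps h).choose_spec.choose_spec.2.2)

theorem rhoComp_eq {i : Fin (n + 1)} {x y : (rho F).cell (n + 1)}
    {a b : (singularCubes F).cell (n + 1)} (hx : x = toRho F a) (hy : y = toRho F b)
    (h : (singularCubes F).face true i a = (singularCubes F).face false i b) (h') :
    rhoComp i x y h' = toRho F (cubeComp i a b h) := by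
  have hs := (exists_reps h').choose_spec.choose_spec
  exact toRho_eq_iff.2 (cubeComp_homRel _ _ (toRho_eq_iff.1 (hs.1.trans hx))
    (toRho_eq_iff.1 (hs.2.1.trans hy)))

theorem rhoComp_toRho {i : Fin (n + 1)} {a b : (singularCubes F).cell (n + 1)}
    (h : (singularCubes F).face true i a = (singularCubes F).face false i b) (h') :
    rhoComp i (toRho F a) (toRho F b) h' = toRho F (cubeComp i a b h) :=
  rhoComp_eq rfl rfl h h'

/-- Stated with equations for `x` and `y`, so that it applies when these are themselves composites;
it also supplies the composability demanded by the compound laws. -/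
theorem exists_rhoComp_eq {i : Fin (n + 1)} {x y : (rho F).cell (n + 1)}
    {a b : (singularCubes F).cell (n + 1)} (hx : x = toRho F a) (hy : y = toRho F b)
    (h : (singularCubes F).face true i a = (singularCubes F).face false i b) :
    ∃ h', rhoComp i x y h' = toRho F (cubeComp i a b h) := by
  subst hx hy
  exact ⟨congrArg (toRho F) h, rhoComp_toRho h _⟩

theorem HomRel.reverse {i : Fin n} {a b : (singularCubes F).cell n}
    (h : HomRel ((cubeFilt n).filt 0) a b) :
    HomRel ((cubeFilt n).filt 0) (reverse i a) (reverse i b) := by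
  obtain ⟨A, hA, rfl, rfl, hS⟩ := h.path
  refine .of_path (A := fun t => FilteredCube.reverse i (A t)) ?_ fun t v hv => hS t _ ?_
  · exact hA.comp (f := fun p : I × (Fin n → I) => (p.1, Function.update p.2 i (σ (p.2 i))))
      (continuous_fst.prodMk (continuous_snd.update i (by fun_prop)))
  · exact update_mem_cubeFilt i (by rintro (h | h) <;> simp [h]) hv

/-- The inverse in `ϱ(X_*)`. -/
noncomputable def rhoInv (i : Fin n) : (rho F).cell n → (rho F).cell n :=
  Quotient.map (reverse i) fun _ _ h => HomRel.reverse h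

theorem rhoInv_toRho (i : Fin n) (a : (singularCubes F).cell n) :
    rhoInv i (toRho F a) = toRho F (reverse i a) := rfl

/-- The fundamental cubical `ω`-groupoid of a filtered space. -/
noncomputable def fundamentalOmegaGroupoid (F : FilteredSpace X) :
    OmegaGroupoidStructure (rho F) where
  comp := rhoComp
  inv := rhoInv
  face_false_comp i x y h := by
    obtain ⟨a, b, rfl, rfl, hab⟩ := exists_reps h
    rw [rhoComp_toRho hab]
    exact congrArg (toRho F) (face_false_cubeComp i a b hab)
  face_true_comp i x y h := by
    obtain ⟨a, b, rfl, rfl, hab⟩ := exists_reps h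
    rw [rhoComp_toRho hab]
    exact congrArg (toRho F) (face_true_cubeComp i a b hab)
  assoc i x y z hxy hyz := by
    obtain ⟨a, b, rfl, rfl, hab⟩ := exists_reps hxy
    obtain ⟨c, rfl, hbc⟩ := exists_rep_right hyz
    have h₁ := (face_true_cubeComp i a b hab).trans hbc
    have h₂ := hab.trans (face_false_cubeComp i b c hbc).symm
    obtain ⟨h₁', e₁⟩ := exists_rhoComp_eq (rhoComp_toRho hab hxy) rfl h₁
    obtain ⟨h₂', e₂⟩ := exists_rhoComp_eq rfl (rhoComp_toRho hbc hyz) h₂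
    refine ⟨h₁', h₂', e₁.trans (.trans ?_ e₂.symm)⟩
    exact toRho_eq_iff.2 (cubeComp_assoc i a b c hab hbc h₁ h₂).of_ends
  degen_comp_self i x := by
    obtain ⟨a, rfl⟩ := exists_toRho x
    obtain ⟨h', e⟩ := exists_rhoComp_eq (F := F) rfl rfl ((singularCubes F).face_degen_self true i
      ((singularCubes F).face false i a))
    exact ⟨h', e.trans (toRho_eq_iff.2 (degen_cubeComp i a _).of_ends)⟩
  comp_degen_self i x := by
    obtain ⟨a, rfl⟩ := exists_toRho x
    obtain ⟨h', e⟩ := exists_rhoComp_eq (F := F) rfl rfl ((singularCubes F).face_degen_self false i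
      ((singularCubes F).face true i a)).symm
    exact ⟨h', e.trans (toRho_eq_iff.2 (cubeComp_degen i a _).of_ends)⟩
  comp_inv i x := by
    obtain ⟨a, rfl⟩ := exists_toRho x
    obtain ⟨h', e⟩ := exists_rhoComp_eq (F := F) rfl (rhoInv_toRho i a) (face_reverse false i a).symm
    exact ⟨h', e.trans (toRho_eq_iff.2 (cubeComp_reverse i a _).of_ends)⟩
  inv_comp i x := by
    obtain ⟨a, rfl⟩ := exists_toRho x
    obtain ⟨h', e⟩ := exists_rhoComp_eq (F := F) (rhoInv_toRho i a) rfl (face_reverse true i a)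
    exact ⟨h', e.trans (toRho_eq_iff.2 (reverse_cubeComp i a _).of_ends)⟩
  face_comp α i j x y h := by
    obtain ⟨a, b, rfl, rfl, hab⟩ := exists_reps h
    obtain ⟨h₁, e₁⟩ := cubeComp_precomp (coface α i) (coface_update α i j) a b hab
    obtain ⟨h', e'⟩ := exists_rhoComp_eq rfl rfl h₁
    refine ⟨h', .trans ?_ e'.symm⟩
    rw [rhoComp_toRho hab]
    exact congrArg (toRho F) e₁
  degen_comp i j x y h := by
    obtain ⟨a, b, rfl, rfl, hab⟩ := exists_reps h
    obtain ⟨h₁, e₁⟩ := cubeComp_precomp (codegen i) (codegen_update_succAbove i j) a b hab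
    obtain ⟨h', e'⟩ := exists_rhoComp_eq rfl rfl h₁
    refine ⟨h', .trans ?_ e'.symm⟩
    rw [rhoComp_toRho hab]
    exact congrArg (toRho F) e₁
  interchange i j hij x y z w hxy hzw hxz hyw := by
    obtain ⟨a, b, c, d, rfl, rfl, rfl, rfl, hab, hcd, hac, hbd⟩ :=
      exists_square_reps hij hxy hzw hxz hyw
    obtain ⟨h₁, h₂, e⟩ := cubeComp_interchange hij a b c d hab hcd hac hbd
    obtain ⟨h₁', e₁⟩ := exists_rhoComp_eq (rhoComp_toRho hab hxy) (rhoComp_toRho hcd hzw) h₁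
    obtain ⟨h₂', e₂⟩ := exists_rhoComp_eq (rhoComp_toRho hac hxz) (rhoComp_toRho hbd hyw) h₂
    exact ⟨h₁', h₂', e₁.trans ((congrArg (toRho F) e).trans e₂.symm)⟩
  conn_comp_lt α i j hij x y h := by
    obtain ⟨a, b, rfl, rfl, hab⟩ := exists_reps h
    obtain ⟨h₁, e₁⟩ := cubeComp_precomp (coconn α i) (coconn_update_lt α hij) a b hab
    obtain ⟨h', e'⟩ := exists_rhoComp_eq rfl rfl h₁
    refine ⟨h', .trans ?_ e'.symm⟩
    rw [rhoComp_toRho hab]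
    exact congrArg (toRho F) e₁
  conn_comp_gt α i j hij x y h := by
    obtain ⟨a, b, rfl, rfl, hab⟩ := exists_reps h
    obtain ⟨h₁, e₁⟩ := cubeComp_precomp (coconn α i) (coconn_update_gt α hij) a b hab
    obtain ⟨h', e'⟩ := exists_rhoComp_eq rfl rfl h₁
    refine ⟨h', .trans ?_ e'.symm⟩
    rw [rhoComp_toRho hab]
    exact congrArg (toRho F) e₁
  conn_false_comp j x y h := by
    obtain ⟨a, b, rfl, rfl, hab⟩ := exists_reps h
    obtain ⟨h₁, h₂, h₃, e⟩ := conn_false_cubeComp j a b hab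
    obtain ⟨h₁', e₁⟩ := exists_rhoComp_eq rfl rfl h₁
    obtain ⟨h₂', e₂⟩ := exists_rhoComp_eq rfl rfl h₂
    obtain ⟨h₃', e₃⟩ := exists_rhoComp_eq e₁ e₂ h₃
    refine ⟨h₁', h₂', h₃', .trans ?_ e₃.symm⟩
    rw [rhoComp_toRho hab]
    exact congrArg (toRho F) e
  conn_true_comp j x y h := by
    obtain ⟨a, b, rfl, rfl, hab⟩ := exists_reps h
    obtain ⟨h₁, h₂, h₃, e⟩ := conn_true_cubeComp j a b hab
    obtain ⟨h₁', e₁⟩ := exists_rhoComp_eq rfl rfl h₁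
    obtain ⟨h₂', e₂⟩ := exists_rhoComp_eq rfl rfl h₂
    obtain ⟨h₃', e₃⟩ := exists_rhoComp_eq e₁ e₂ h₃
    refine ⟨h₁', h₂', h₃', .trans ?_ e₃.symm⟩
    rw [rhoComp_toRho hab]
    exact congrArg (toRho F) e
  conn_comp_conn_castSucc i x := by
    obtain ⟨a, rfl⟩ := exists_toRho x
    obtain ⟨h, e⟩ := conn_cubeComp_conn_castSucc i a
    obtain ⟨h', e'⟩ := exists_rhoComp_eq rfl rfl h
    exact ⟨h', e'.trans (toRho_eq_iff.2 e)⟩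
  conn_comp_conn_succ i x := by
    obtain ⟨a, rfl⟩ := exists_toRho x
    obtain ⟨h, e⟩ := conn_cubeComp_conn_succ i a
    obtain ⟨h', e'⟩ := exists_rhoComp_eq rfl rfl h
    exact ⟨h', e'.trans (toRho_eq_iff.2 e)⟩

/-! ### Uniqueness -/

/-- The inverse in a cubical `ω`-groupoid is determined by the composition. -/
theorem _root_.OmegaGroupoidStructure.eq_inv {K : ConnCubicalSet.{u}}
    (G : OmegaGroupoidStructure K) (i : Fin (n + 1)) (a b : K.cell (n + 1))
    (h) (hab : G.comp i a b h = K.degen i (K.face false i a)) : b = G.inv i a := by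
  -- The usual computation `b = (a⁻¹ a) b = a⁻¹ (a b) = a⁻¹`.
  obtain ⟨h₁, e₁⟩ := G.inv_comp i a
  obtain ⟨h₂, h₃, e₂⟩ := G.assoc i (G.inv i a) a b h₁ h
  obtain ⟨h₄, e₄⟩ := G.degen_comp_self i b
  obtain ⟨h₅, e₅⟩ := G.comp_degen_self i (G.inv i a)
  simp only [e₁, hab, h] at e₂
  rw [e₄] at e₂
  simp only [h₁] at e₅
  exact e₂.trans e₅

/-- Composition determines the inverse, and all the other fields are propositions. -/
theorem _root_.OmegaGroupoidStructure.ext_comp {K : ConnCubicalSet.{u}}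
    {G G' : OmegaGroupoidStructure K}
    (h : ∀ {n : ℕ} (i : Fin (n + 1)) (a b : K.cell (n + 1)) (hab),
      G.comp i a b hab = G'.comp i a b hab) : G = G' := by
  have hc : @OmegaGroupoidStructure.comp K G = @OmegaGroupoidStructure.comp K G' := by
    funext n i a b hab; exact h i a b hab
  have hi : @OmegaGroupoidStructure.inv K G = @OmegaGroupoidStructure.inv K G' := by
    funext n i a
    obtain ⟨h₁, e⟩ := G.comp_inv i a
    exact G'.eq_inv i a _ h₁ ((h i a _ h₁).symm.trans e)
  cases G
  cases G'
  simp only at hc hi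
  subst hc hi
  rfl

end FilteredCube

open FilteredCube in
theorem mainTheorem3 {X : Type u} [TopologicalSpace X] (F : FilteredSpace X) :
    (∀ {n : ℕ} (i : Fin (n + 1)) (x y : (rho F).cell (n + 1)),
      (rho F).face true i x = (rho F).face false i y →
      ∃ a b : (singularCubes F).cell (n + 1), toRho F a = x ∧ toRho F b = y ∧
        (singularCubes F).face true i a = (singularCubes F).face false i b) ∧
    (∀ {n : ℕ} (i : Fin (n + 1)) (a a' b b' : (singularCubes F).cell (n + 1))
      (h : (singularCubes F).face true i a = (singularCubes F).face false i b)
      (h' : (singularCubes F).face true i a' = (singularCubes F).face false i b'),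
      FilteredHomotopic a a' → FilteredHomotopic b b' →
      FilteredHomotopic (cubeComp i a b h) (cubeComp i a' b' h')) ∧
    ∃! G : OmegaGroupoidStructure (rho F),
      ∀ {n : ℕ} (i : Fin (n + 1)) (a b : (singularCubes F).cell (n + 1))
        (h : (singularCubes F).face true i a = (singularCubes F).face false i b),
        G.comp i (toRho F a) (toRho F b) (congrArg (toRho F) h) = toRho F (cubeComp i a b h) := by
  refine ⟨fun _ _ _ h => exists_reps h, fun _ _ _ _ _ h h' ha hb => cubeComp_homRel h h' ha hb,
    fundamentalOmegaGroupoid F, fun _ _ _ h => rhoComp_toRho h (congrArg (toRho F) h), fun G hG => ?_⟩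
  -- Every composable pair of classes has strictly composable representatives, so the prescribed
  -- values cover the whole domain of composition.
  refine OmegaGroupoidStructure.ext_comp fun i x y h => ?_
  obtain ⟨a, b, rfl, rfl, hab⟩ := exists_reps h
  exact (hG i a b hab).trans (rhoComp_toRho hab h).symm
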